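/- Let $n>2$. For $z\in\mathbb{C}^n$ (row vector) put $zz^t=z_1^2+\cdots+z_n^2$, and let $$\mathscr{D}=\{z\in\mathbb{C}^n : 1-2|z|^2+|zz^t|^2>0,\ |z|<1\}$$ be the Lie ball, $\mathscr{X}=\mathscr{D}\cap\mathbb{R}^n$ its real part (which is the open unit ball of $\mathbb{R}^n$), and $M=\{Z\in M_{n2}(\mathbb{R}) : Z^tZ<I_2\}$. The Hua transform is $$\mathcal{H}(z)=2\left(\begin{pmatrix} zz^t+1 & i(zz^t-1)\\ \overline{zz^t}+1 & -i(\overline{zz^t}-1)\end{pmatrix}^{-1}\begin{pmatrix} z\\ \overline z\end{pmatrix}\right)^t ,$$ a real $n\times 2$ matrix. For $p\in\{1,2\}$ let $SO(p,n)$ be the group of real matrices of determinant $1$ preserving $x_1y_1+\cdots+x_py_p-x_{p+1}y_{p+1}-\cdots-x_{p+n}y_{p+n}$, and let $SO_0(p,n)$ be its identity component. An element $\begin{pmatrix}A&B\\C&D\end{pmatrix}$ of $SO(2,n)$ acts on $M$ by $Z\mapsto (C+DZ)(A+BZ)^{-1}$, and $SO(1,n)$ is embedded in $SO(2,n)$ by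 $$\theta:\begin{pmatrix}a&b\\c&D\end{pmatrix}\mapsto\begin{pmatrix}a&0&b\\0&1&0\\c&0&D\end{pmatrix}.$$ Let $\mathrm{Aut}(\mathscr{D})$ be the group of biholomorphic self-maps of $\mathscr{D}$ with the compact-open topology, $G$ its identity component, and $H$ the identity component (the connected component of the identity) of $\{h\in G : h(x)\in\mathscr{X}\text{ for all }x\in\mathscr{X}\}$. Then: 1. $\mathcal{H}$ is a bijection of $\mathscr{D}$ onto $M$, and it maps $\mathscr{X}$ diffeomorphically onto $\mathcal{H}(\mathscr{X})=\{(X\ 0) : X\in M_{n1}(\mathbb{R}),\ |X|<1\}$, by $x\mapsto \left(\frac{2x}{1+|x|^2}\ \ 0\right)$. 2. $H$ is a group, and $h\mapsto \mathcal{H}h\mathcal{H}^{-1}$ is an isomorphism of (topological) groups from $H$ onto $SO_0(1,n)$, acting on $M$ through $\theta$; that is, there is an isomorphism of topological groups $\Phi:H\to SO_0(1,n)$ with $\mathcal{H}(h(z))=\theta(\Phi(h))\cdot\mathcal{H}(z)$ for all $h\in H$, $z\in\mathscr{D}$. 3. The same holds if $G$ is taken to be $SO_0(2,n)$, acting on $\mathscr{D}$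 by $z\mapsto\mathcal{H}^{-1}(g\cdot\mathcal{H}(z))$: the identity component of $\{g\in SO_0(2,n) : \mathcal{H}^{-1}(g\cdot\mathcal{H}(x))\in\mathscr{X}\text{ for all }x\in\mathscr{X}\}$ is a subgroup, and $\theta$ restricts to an isomorphism of topological groups from $SO_0(1,n)$ onto it. -/

import Mathlib

open scoped ContDiff Matrix ComplexConjugate

noncomputable section

namespace LieBall

/-! ### The Lie ball, its real part, and the group of its holomorphic automorphisms -/

/-- The quadratic form `z zᵗ = z₁² + ⋯ + zₙ²` on `ℂⁿ`. -/
def quad {n : ℕ} (z : EuclideanSpace ℂ (Fin n)) : ℂ := ∑ i, z i ^ 2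

/-- The Lie ball `𝓓 = {z ∈ ℂⁿ | 1 - 2⟨z,z⟩ + |z zᵗ|² > 0, |z| < 1}`. -/
def lieBall (n : ℕ) : Set (EuclideanSpace ℂ (Fin n)) :=
  {z | 0 < 1 - 2 * ‖z‖ ^ 2 + ‖quad z‖ ^ 2 ∧ ‖z‖ < 1}

/-- The inclusion `ℝⁿ ⊆ ℂⁿ`. -/
def ofRealVec {n : ℕ} (x : EuclideanSpace ℝ (Fin n)) : EuclideanSpace ℂ (Fin n) :=
  WithLp.toLp 2 fun i => (x i : ℂ)

/-- The real part `𝓧 = 𝓓 ∩ ℝⁿ`. -/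
def realPart (n : ℕ) : Set (EuclideanSpace ℂ (Fin n)) :=
  lieBall n ∩ Set.range ofRealVec

/-- A self-map of the Lie ball is holomorphic if it is the restriction of a function on `ℂⁿ` that
is complex differentiable on the (open) set `𝓓`. -/
def IsHolo {n : ℕ} (f : lieBall n → lieBall n) : Prop :=
  ∃ F : EuclideanSpace ℂ (Fin n) → EuclideanSpace ℂ (Fin n),
    DifferentiableOn ℂ F (lieBall n) ∧ ∀ z : lieBall n, F z = f z

/-- The group `Aut(𝓓)` of biholomorphic self-maps of the Lie ball, under composition. -/
def aut (n : ℕ) : Subgroup (lieBall n ≃ₜ lieBall n) where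
  carrier := {f | IsHolo f ∧ IsHolo f.symm}
  one_mem' := ⟨⟨id, differentiableOn_id, fun _ => rfl⟩, ⟨id, differentiableOn_id, fun _ => rfl⟩⟩
  inv_mem' := fun h => ⟨h.2, h.1⟩
  mul_mem' := by
    have key : ∀ f g : lieBall n → lieBall n, IsHolo f → IsHolo g → IsHolo (f ∘ g) := by
      rintro f g ⟨F, hF, hFf⟩ ⟨G, hG, hGg⟩
      refine ⟨F ∘ G, hF.comp hG fun z hz => ?_, fun z => ?_⟩
      · rw [hGg ⟨z, hz⟩]
        exact (g ⟨z, hz⟩).2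
      · simp [hGg z, hFf (g z)]
    rintro f g ⟨hf, hf'⟩ ⟨hg, hg'⟩
    exact ⟨key f g hf hg, key g.symm f.symm hg' hf'⟩

/-- `Aut(𝓓)` carries the compact-open topology. -/
instance (n : ℕ) : TopologicalSpace (aut n) :=
  TopologicalSpace.induced
    (fun f => (⟨f.1, f.1.continuous⟩ : C(lieBall n, lieBall n))) inferInstance

/-- The group `G`, as the identity component of `Aut(𝓓)`. -/
def autZero (n : ℕ) : Set (aut n) := connectedComponent 1

/-- The identity component of `{h ∈ G | h(x) ∈ 𝓧 if x ∈ 𝓧}`, where `G` is the identity component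
of `Aut(𝓓)`. -/
def groupH (n : ℕ) : Set (aut n) :=
  connectedComponentIn
    {h | h ∈ autZero n ∧ ∀ x : lieBall n, (x : EuclideanSpace ℂ (Fin n)) ∈ realPart n →
      (h.1 x : EuclideanSpace ℂ (Fin n)) ∈ realPart n} 1

/-! ### The groups `SO(p,q)` and `SO₀(p,q)` -/

/-- The form `(x|y) = x₁y₁ + ⋯ + x_p y_p - x_{p+1}y_{p+1} - ⋯ - x_{p+q}y_{p+q}`. -/
def form (p q : ℕ) (x y : Fin p ⊕ Fin q → ℝ) : ℝ :=
  ∑ i, x (Sum.inl i) * y (Sum.inl i) - ∑ j, x (Sum.inr j) * y (Sum.inr j)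

/-- The group `SO(p,q)` of real matrices of determinant one that preserve the form. -/
def SO (p q : ℕ) : Subgroup (Matrix.SpecialLinearGroup (Fin p ⊕ Fin q) ℝ) where
  carrier := {g | ∀ x y, form p q (g.1 *ᵥ x) (g.1 *ᵥ y) = form p q x y}
  one_mem' := by intro x y; simp
  mul_mem' := by
    intro g h hg hh x y
    have hg' := hg (h.1 *ᵥ x) (h.1 *ᵥ y)
    rw [hh x y] at hg'
    simpa [Matrix.mulVec_mulVec] using hg'
  inv_mem' := by
    intro g hg x y
    have hgi : g.1 * (g⁻¹).1 = 1 := by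
      rw [← Matrix.SpecialLinearGroup.coe_mul, mul_inv_cancel, Matrix.SpecialLinearGroup.coe_one]
    have h := hg ((g⁻¹).1 *ᵥ x) ((g⁻¹).1 *ᵥ y)
    rw [Matrix.mulVec_mulVec, Matrix.mulVec_mulVec, hgi, Matrix.one_mulVec,
      Matrix.one_mulVec] at h
    exact h.symm

/-- `SO₀(p,q)`, the identity component of `SO(p,q)`. -/
def SOZero (p q : ℕ) : Subgroup (SO p q) := Subgroup.connectedComponentOfOne (SO p q)

/-- The underlying matrix of an element of `SO(p,q)`. -/
def soMat {p q : ℕ} (g : SO p q) : Matrix (Fin p ⊕ Fin q) (Fin p ⊕ Fin q) ℝ := g.1.1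

/-- The matrix
`(a b; c D) ↦ (a 0 b; 0 1 0; c 0 D)` of size `2 + n`, for a matrix of size `1 + n`. -/
def thetaMat {n : ℕ} (g : Matrix (Fin 1 ⊕ Fin n) (Fin 1 ⊕ Fin n) ℝ) :
    Matrix (Fin 2 ⊕ Fin n) (Fin 2 ⊕ Fin n) ℝ :=
  Matrix.fromBlocks
    !![g (Sum.inl 0) (Sum.inl 0), 0; 0, 1]
    (Matrix.of ![fun j => g (Sum.inl 0) (Sum.inr j), fun _ => 0])
    (Matrix.of fun i => ![g (Sum.inr i) (Sum.inl 0), 0])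
    g.toBlocks₂₂

theorem thetaMat_mul {n : ℕ} (g h : Matrix (Fin 1 ⊕ Fin n) (Fin 1 ⊕ Fin n) ℝ) :
    thetaMat (g * h) = thetaMat g * thetaMat h := by
  ext i j
  rcases i with i | i <;> rcases j with j | j
  all_goals try fin_cases i
  all_goals try fin_cases j
  all_goals simp [thetaMat, Matrix.mul_apply, Matrix.toBlocks₂₂]

theorem thetaMat_one {n : ℕ} :
    thetaMat (1 : Matrix (Fin 1 ⊕ Fin n) (Fin 1 ⊕ Fin n) ℝ) = 1 := by
  ext i j
  rcases i with i | i <;> rcases j with j | j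
  all_goals try fin_cases i
  all_goals try fin_cases j
  all_goals simp [thetaMat, Matrix.toBlocks₂₂, Matrix.one_apply]

theorem thetaMat_det {n : ℕ} (g : Matrix (Fin 1 ⊕ Fin n) (Fin 1 ⊕ Fin n) ℝ) :
    (thetaMat g).det = g.det := by
  let e : Fin 2 ⊕ Fin n ≃ Fin 1 ⊕ (Fin 1 ⊕ Fin n) :=
    { toFun := Sum.elim ![Sum.inr (Sum.inl 0), Sum.inl 0] (fun j => Sum.inr (Sum.inr j))
      invFun := Sum.elim (fun _ => Sum.inl 1)
        (Sum.elim (fun _ => Sum.inl 0) (fun j => Sum.inr j))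
      left_inv := by
        rintro (i | i)
        · fin_cases i <;> rfl
        · rfl
      right_inv := by
        rintro (i | i | i)
        · fin_cases i; rfl
        · fin_cases i; rfl
        · rfl }
  have h : thetaMat g = (Matrix.fromBlocks (1 : Matrix (Fin 1) (Fin 1) ℝ) 0 0 g).submatrix e e := by
    ext i j
    rcases i with i | i <;> rcases j with j | j
    all_goals try fin_cases i
    all_goals try fin_cases j
    all_goals simp [thetaMat, e, Matrix.toBlocks₂₂]
  rw [h, Matrix.det_submatrix_equiv_self, Matrix.det_fromBlocks_zero₂₁, Matrix.det_one, one_mul]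

theorem thetaMat_form {n : ℕ} (g : Matrix (Fin 1 ⊕ Fin n) (Fin 1 ⊕ Fin n) ℝ)
    (hg : ∀ x y, form 1 n (g *ᵥ x) (g *ᵥ y) = form 1 n x y) (x y : Fin 2 ⊕ Fin n → ℝ) :
    form 2 n (thetaMat g *ᵥ x) (thetaMat g *ᵥ y) = form 2 n x y := by
  let r : (Fin 2 ⊕ Fin n → ℝ) → Fin 1 ⊕ Fin n → ℝ :=
    fun x => Sum.elim (fun _ => x (Sum.inl 0)) (fun j => x (Sum.inr j))
  have h0 : ∀ x, (thetaMat g *ᵥ x) (Sum.inl 0) = (g *ᵥ r x) (Sum.inl 0) := by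
    intro x
    simp [thetaMat, r, Matrix.mulVec, dotProduct]
  have h1 : ∀ x, (thetaMat g *ᵥ x) (Sum.inl 1) = x (Sum.inl 1) := by
    intro x
    simp [thetaMat, Matrix.mulVec, dotProduct]
  have h2 : ∀ x j, (thetaMat g *ᵥ x) (Sum.inr j) = (g *ᵥ r x) (Sum.inr j) := by
    intro x j
    simp [thetaMat, r, Matrix.mulVec, dotProduct, Matrix.toBlocks₂₂]
  have h := hg (r x) (r y)
  simp only [form, Fin.sum_univ_two, Finset.univ_unique, Finset.sum_singleton,
    Fin.default_eq_zero, h0, h1, h2] at h ⊢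
  simp only [r, Sum.elim_inl, Sum.elim_inr] at h ⊢
  linarith

/-- The embedding `θ : SO(1,n) → SO(2,n)`. -/
def theta (n : ℕ) : SO 1 n →* SO 2 n where
  toFun g := ⟨⟨thetaMat (soMat g), (thetaMat_det _).trans g.1.2⟩, thetaMat_form (soMat g) g.2⟩
  map_one' := Subtype.ext <| Subtype.ext thetaMat_one
  map_mul' g h := Subtype.ext <| Subtype.ext <| thetaMat_mul (soMat g) (soMat h)

/-! ### The matrix ball `M` and the action of `SO(2,n)` on it -/

/-- The set `M = {Z ∈ M_{n2}(ℝ) | Zᵗ Z < I₂}`. -/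
def matBall (n : ℕ) : Set (Matrix (Fin n) (Fin 2) ℝ) := {Z | (1 - Zᵀ * Z).PosDef}

/-- The fractional linear action `Z ↦ (C + D Z)(A + B Z)⁻¹` of a matrix `(A B; C D)`. -/
def mobius {p q : ℕ} (g : SO p q) (Z : Matrix (Fin q) (Fin p) ℝ) : Matrix (Fin q) (Fin p) ℝ :=
  ((soMat g).toBlocks₂₁ + (soMat g).toBlocks₂₂ * Z) * ((soMat g).toBlocks₁₁ + (soMat g).toBlocks₁₂ * Z)⁻¹

/-- The matrix `(X 0)` with columns `X` and `0`. -/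
def colZero {n : ℕ} (X : EuclideanSpace ℝ (Fin n)) : Matrix (Fin n) (Fin 2) ℝ :=
  Matrix.of fun i => ![X i, 0]

/-! ### The Hua transform -/

/-- The `2 × 2` matrix in the definition of the Hua transform. -/
def huaCoeff {n : ℕ} (z : EuclideanSpace ℂ (Fin n)) : Matrix (Fin 2) (Fin 2) ℂ :=
  !![quad z + 1, Complex.I * (quad z - 1);
     conj (quad z) + 1, -Complex.I * (conj (quad z) - 1)]

/-- The `2 × n` matrix with rows `z` and `z̄`. -/
def huaRows {n : ℕ} (z : EuclideanSpace ℂ (Fin n)) : Matrix (Fin 2) (Fin n) ℂ :=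
  Matrix.of ![fun j => z j, fun j => conj (z j)]

/-- The defining formula of the Hua transform, as a complex matrix. -/
def huaComplex {n : ℕ} (z : EuclideanSpace ℂ (Fin n)) : Matrix (Fin n) (Fin 2) ℂ :=
  (2 : ℂ) • ((huaCoeff z)⁻¹ * huaRows z)ᵀ

/-- The Hua transform `𝓗`, as a real matrix; see `huaComplex_eq_hua`. -/
def hua {n : ℕ} (z : EuclideanSpace ℂ (Fin n)) : Matrix (Fin n) (Fin 2) ℝ :=
  (huaComplex z).map Complex.re

/-- The formula for the Hua transform has real entries. -/
theorem huaComplex_eq_hua {n : ℕ} (z : EuclideanSpace ℂ (Fin n)) :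
    huaComplex z = (hua z).map (fun r : ℝ => (r : ℂ)) := by
  have hdet : (huaCoeff z).det = -Complex.I * ((quad z + 1) * (conj (quad z) - 1)
      + (quad z - 1) * (conj (quad z) + 1)) := by
    rw [huaCoeff, Matrix.det_fin_two_of]; ring
  have hI : conj Complex.I = -Complex.I := Complex.conj_I
  have hd : conj (huaCoeff z).det = -(huaCoeff z).det := by
    rw [hdet]; simp only [map_mul, map_add, map_sub, map_one, map_neg, hI, Complex.conj_conj]; ring
  have hdi : conj (Ring.inverse (huaCoeff z).det) = -Ring.inverse (huaCoeff z).det := by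
    rw [Ring.inverse_eq_inv', map_inv₀, hd, inv_neg]
  have key : ∀ i j, conj (huaComplex z i j) = huaComplex z i j := by
    intro i j
    fin_cases j <;>
    · have h2 : conj (2 : ℂ) = 2 := map_ofNat _ 2
      simp only [huaComplex, h2, Matrix.inv_def, Matrix.smul_apply, Matrix.transpose_apply,
        Matrix.mul_apply, Fin.sum_univ_two, smul_eq_mul, map_mul, map_add, hdi]
      simp [huaCoeff, huaRows, Matrix.adjugate_fin_two_of, hI]
      ring
  ext i j
  simp only [hua, Matrix.map_apply]
  exact (Complex.conj_eq_iff_re.mp (key i j)).symm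

end LieBall

end

/-!
A point `z` of the Lie ball is encoded by the isotropic line of `ℂ²⁺ⁿ` through
`((1 + z zᵗ) / 2, -i (1 - z zᵗ) / 2, z)`. The real span of the real and imaginary parts of this
vector is a positive plane, and `𝓗(z)` is the matrix of which it is the graph. The linear action of
`SO₀(2,n)` on isotropic lines thus becomes both a holomorphic action on the Lie ball and, through
`𝓗`, the Möbius action on `M`. Inverting `𝓗` amounts to finding the isotropic vectors of a positive
definite binary quadratic form, and on the real part `𝓗` is the passage from the Poincaré to the
Klein model of hyperbolic space.

Compose an automorphism that preserves the real part with a half turn from `θ(O(1,n))` so that it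
fixes the origin. By Schwarz's lemma, applied to it and to its inverse, it is a linear isometry on
the real part; a holomorphic map is determined by its values at real points, so the automorphism is
induced by a matrix `θ(g)`. The images of finitely many real points determine `g`, continuously in
the automorphism, and connectedness puts `g` in `SO₀(1,n)`.

An element of `SO₀(2,n)` preserving the real part maps the graph of each matrix `(X 0)` onto the
graph of another one. All of them contain the second basis vector `e₂`, so that its preimage lies in
their intersection, the line of `e₂`. Hence `e₂` is mapped to `±e₂`, and the sign is constant on a
connected set.
-/

noncomputable section

namespace LieBall

/-! ### Connected components and embeddings of topological groups -/

section Topology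

theorem pos_of_isPreconnected {X : Type*} [TopologicalSpace X] {s : Set X} (hs : IsPreconnected s)
    {f : X → ℝ} (hf : ContinuousOn f s) (hne : ∀ x ∈ s, f x ≠ 0) {a b : X} (ha : a ∈ s)
    (hb : b ∈ s) (hpos : 0 < f a) : 0 < f b := by
  by_contra! hnonpos
  obtain ⟨c, hc, hc0⟩ := hs.intermediate_value hb ha hf ⟨hnonpos, hpos.le⟩
  exact hne c hc hc0

variable {A B : Type*} [Group A] [Group B] [TopologicalSpace A] [TopologicalSpace B]

theorem range_subset_connectedComponentIn [PreconnectedSpace A] {Ψ : A →* B} (hΨ : Continuous Ψ)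
    {S : Set B} (hS : ∀ a, Ψ a ∈ S) :
    (Ψ.range : Set B) ⊆ connectedComponentIn (connectedComponent 1 ∩ S) 1 := by
  have hrange : IsPreconnected (Ψ.range : Set B) := by
    rw [MonoidHom.coe_range]
    exact isPreconnected_range hΨ
  refine hrange.subset_connectedComponentIn (one_mem _) fun b hb =>
    ⟨hrange.subset_connectedComponent (one_mem _) hb, ?_⟩
  obtain ⟨a, rfl⟩ := hb
  exact hS a

theorem exists_range_continuousMulEquiv {Ψ : A →* B} (hΨ : Topology.IsEmbedding Ψ) :
    ∃ Φ : Ψ.range ≃ₜ* A, ∀ b, Ψ (Φ b) = b := by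
  let e : A ≃* Ψ.range := Ψ.ofInjective hΨ.injective
  have he : Continuous e := hΨ.continuous.subtype_mk _
  have hΨ_symm (b : Ψ.range) : Ψ (e.symm b) = b := congrArg Subtype.val (e.apply_symm_apply b)
  have he_symm : Continuous e.symm :=
    hΨ.continuous_iff.2 (continuous_subtype_val.congr fun b => (hΨ_symm b).symm)
  exact ⟨{ e.symm with continuous_toFun := he_symm, continuous_invFun := he }, hΨ_symm⟩

end Topology

/-! ### The groups `SO(p,q)` -/

section IndefiniteOrthogonal

variable {p q : ℕ}

theorem isEmbedding_soMat : Topology.IsEmbedding (soMat (p := p) (q := q)) :=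
  Topology.IsEmbedding.subtypeVal.comp Topology.IsEmbedding.subtypeVal

instance : PreconnectedSpace (SOZero p q) :=
  Subtype.preconnectedSpace (isPreconnected_connectedComponent (x := (1 : SO p q)))

/-- A real square matrix of any determinant preserves the form of signature `(p,q)`, that is,
belongs to `O(p,q)`. -/
def PreservesForm (g : Matrix (Fin p ⊕ Fin q) (Fin p ⊕ Fin q) ℝ) : Prop :=
  ∀ x y, form p q (g *ᵥ x) (g *ᵥ y) = form p q x y

theorem exists_mem_SOZero_of_isPreconnected {X : Type*} [TopologicalSpace X] {s : Set X}
    (hs : IsPreconnected s) {f : X → Matrix (Fin p ⊕ Fin q) (Fin p ⊕ Fin q) ℝ} (hf : Continuous f)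
    (hform : ∀ x ∈ s, PreservesForm (f x))
    (hdet : ∀ x ∈ s, (f x).det = 1) {a b : X} (ha : a ∈ s) (hb : b ∈ s) (hfa : f a = 1) :
    ∃ g ∈ SOZero p q, soMat g = f b := by
  let σ : s → SO p q := fun x => ⟨⟨f x, hdet x x.2⟩, hform x x.2⟩
  have hσ : Continuous σ := ((hf.comp continuous_subtype_val).subtype_mk _).subtype_mk _
  have : PreconnectedSpace s := Subtype.preconnectedSpace hs
  have hone : (1 : SO p q) ∈ Set.range σ := ⟨⟨a, ha⟩, Subtype.ext (Subtype.ext hfa)⟩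
  exact ⟨σ ⟨b, hb⟩, (isPreconnected_range hσ).subset_connectedComponent hone ⟨_, rfl⟩, rfl⟩

/-- The form `(x|y)` of signature `(p,q)` over an arbitrary ring; `form p q` is the case `R = ℝ`.
Over `ℂ` it is the complex-bilinear extension of `form p q`, and `(star x|x)` is the associated
Hermitian form. -/
def formOver (R : Type*) [CommRing R] (x y : Fin p ⊕ Fin q → R) : R :=
  ∑ i, x (Sum.inl i) * y (Sum.inl i) - ∑ j, x (Sum.inr j) * y (Sum.inr j)

open LieAlgebra.Orthogonal (indefiniteDiagonal)

section CommRing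

variable {R : Type*} [CommRing R]

theorem formOver_eq_dotProduct_mulVec (x y : Fin p ⊕ Fin q → R) :
    formOver R x y = x ⬝ᵥ indefiniteDiagonal (Fin p) (Fin q) R *ᵥ y := by
  simp [formOver, indefiniteDiagonal, dotProduct, Matrix.mulVec_diagonal, sub_eq_add_neg]

theorem formOver_mulVec_mulVec (g : Matrix (Fin p ⊕ Fin q) (Fin p ⊕ Fin q) R)
    (x y : Fin p ⊕ Fin q → R) :
    formOver R (g *ᵥ x) (g *ᵥ y) =
      x ⬝ᵥ (gᵀ * indefiniteDiagonal (Fin p) (Fin q) R * g) *ᵥ y := by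
  rw [formOver_eq_dotProduct_mulVec, Matrix.dotProduct_mulVec, Matrix.vecMul_mulVec,
    ← Matrix.dotProduct_mulVec, Matrix.mulVec_mulVec]

theorem formOver_graph (Z : Matrix (Fin q) (Fin p) R) (u v : Fin p → R) :
    formOver R (Sum.elim u (Z *ᵥ u)) (Sum.elim v (Z *ᵥ v)) = u ⬝ᵥ (1 - Zᵀ * Z) *ᵥ v := by
  rw [Matrix.sub_mulVec, Matrix.one_mulVec, ← Matrix.mulVec_mulVec, dotProduct_sub,
    Matrix.dotProduct_mulVec u Zᵀ, Matrix.vecMul_transpose]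
  rfl

theorem mulVec_graph (g : Matrix (Fin p ⊕ Fin q) (Fin p ⊕ Fin q) R) (Z : Matrix (Fin q) (Fin p) R)
    (u : Fin p → R) :
    g *ᵥ Sum.elim u (Z *ᵥ u) = Sum.elim ((g.toBlocks₁₁ + g.toBlocks₁₂ * Z) *ᵥ u)
      ((g.toBlocks₂₁ + g.toBlocks₂₂ * Z) *ᵥ u) := by
  conv_lhs => rw [← Matrix.fromBlocks_toBlocks g]
  simp [Matrix.fromBlocks_mulVec, Matrix.add_mulVec]

end CommRing

theorem indefiniteDiagonal_mul_self (R : Type*) [CommRing R] :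
    indefiniteDiagonal (Fin p) (Fin q) R * indefiniteDiagonal (Fin p) (Fin q) R = 1 := by
  rw [indefiniteDiagonal, Matrix.diagonal_mul_diagonal, ← Matrix.diagonal_one]
  congr 1
  ext (i | i) <;> simp

namespace PreservesForm

variable {g h : Matrix (Fin p ⊕ Fin q) (Fin p ⊕ Fin q) ℝ}

theorem iff_transpose_mul_mul :
    PreservesForm g ↔
      gᵀ * indefiniteDiagonal (Fin p) (Fin q) ℝ * g = indefiniteDiagonal (Fin p) (Fin q) ℝ := by
  change (∀ x y, formOver ℝ (g *ᵥ x) (g *ᵥ y) = formOver ℝ x y) ↔ _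
  simp only [formOver_mulVec_mulVec]
  simp only [formOver_eq_dotProduct_mulVec]
  refine ⟨fun h => Matrix.ext_iff_mulVec.2 fun y => dotProduct_eq _ _ fun x => ?_,
    fun h x y => by rw [h]⟩
  rw [dotProduct_comm, h, dotProduct_comm]

theorem det_sq (hg : PreservesForm g) :
    g.det ^ 2 = 1 := by
  have hJ : (indefiniteDiagonal (Fin p) (Fin q) ℝ).det ≠ 0 := by
    simp [indefiniteDiagonal]
  have hdet := congrArg Matrix.det (iff_transpose_mul_mul.1 hg)
  rw [Matrix.det_mul, Matrix.det_mul, Matrix.det_transpose] at hdet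
  exact mul_left_cancel₀ hJ (by linear_combination hdet)

protected theorem mul (hg : PreservesForm g) (hh : PreservesForm h) : PreservesForm (g * h) :=
  fun x y => by rw [← Matrix.mulVec_mulVec, ← Matrix.mulVec_mulVec, hg, hh]

theorem isUnit_det (hg : PreservesForm g) : IsUnit g.det :=
  .of_pow_eq_one hg.det_sq two_ne_zero

protected theorem inv (hg : PreservesForm g) : PreservesForm g⁻¹ := fun x y => by
  rw [← hg, Matrix.mulVec_mulVec, Matrix.mulVec_mulVec, Matrix.mul_nonsing_inv g hg.isUnit_det,
    Matrix.one_mulVec, Matrix.one_mulVec]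

theorem inv_eq (hg : PreservesForm g) :
    g⁻¹ = indefiniteDiagonal (Fin p) (Fin q) ℝ * gᵀ * indefiniteDiagonal (Fin p) (Fin q) ℝ := by
  refine Matrix.inv_eq_left_inv ?_
  rw [Matrix.mul_assoc, Matrix.mul_assoc, ← Matrix.mul_assoc gᵀ, iff_transpose_mul_mul.1 hg,
    indefiniteDiagonal_mul_self]

theorem formOver_map_mulVec (hg : PreservesForm g)
    {S : Type*} [CommRing S] (f : ℝ →+* S) (v w : Fin p ⊕ Fin q → S) :
    formOver S (g.map f *ᵥ v) (g.map f *ᵥ w) = formOver S v w := by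
  have hJ : indefiniteDiagonal (Fin p) (Fin q) S =
      (indefiniteDiagonal (Fin p) (Fin q) ℝ).map f := by
    rw [indefiniteDiagonal, indefiniteDiagonal, Matrix.diagonal_map (map_zero f)]
    congr 1
    ext (i | i) <;> simp
  rw [formOver_mulVec_mulVec, formOver_eq_dotProduct_mulVec, hJ, ← Matrix.transpose_map,
    ← Matrix.map_mul, ← Matrix.map_mul, iff_transpose_mul_mul.1 hg]

theorem det_mobiusDenominator_ne_zero (hg : PreservesForm g)
    {Z : Matrix (Fin q) (Fin p) ℝ} (hZ : (1 - Zᵀ * Z).PosDef) :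
    (g.toBlocks₁₁ + g.toBlocks₁₂ * Z).det ≠ 0 := by
  intro hdet
  obtain ⟨u, hu, hNu⟩ := Matrix.exists_mulVec_eq_zero_iff.2 hdet
  have hpos : 0 < u ⬝ᵥ (1 - Zᵀ * Z) *ᵥ u := hZ.dotProduct_mulVec_pos hu
  rw [← formOver_graph] at hpos
  have hgu := hg (Sum.elim u (Z *ᵥ u)) (Sum.elim u (Z *ᵥ u))
  rw [mulVec_graph, hNu] at hgu
  refine absurd (hpos.trans_eq hgu.symm) (not_lt.2 ?_)
  simp [form, Finset.sum_nonneg, mul_self_nonneg]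

end PreservesForm

end IndefiniteOrthogonal

/-! ### From the Poincaré model to the Klein model of the ball -/

section PoincareToKlein

section NormedSpace

variable {E : Type*} [NormedAddCommGroup E] [NormedSpace ℝ E]

/-- The map `x ↦ 2x / (1 + |x|²)` of the unit ball, which passes from the Poincaré model of
hyperbolic space to the Klein model. -/
def poincareToKleinFun (x : E) : E := (2 / (1 + ‖x‖ ^ 2)) • x

/-- The inverse `X ↦ X / (1 + √(1 - |X|²))` of `poincareToKleinFun` on the unit ball. -/
def kleinToPoincareFun (X : E) : E := (1 / (1 + √(1 - ‖X‖ ^ 2))) • X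

theorem norm_poincareToKleinFun (x : E) :
    ‖poincareToKleinFun x‖ = 2 * ‖x‖ / (1 + ‖x‖ ^ 2) := by
  rw [poincareToKleinFun, norm_smul, Real.norm_of_nonneg (by positivity), div_mul_eq_mul_div]

theorem norm_kleinToPoincareFun (X : E) :
    ‖kleinToPoincareFun X‖ = ‖X‖ / (1 + √(1 - ‖X‖ ^ 2)) := by
  rw [kleinToPoincareFun, norm_smul, Real.norm_of_nonneg (by positivity), one_div_mul_eq_div]

theorem norm_poincareToKleinFun_lt_one {x : E} (hx : ‖x‖ < 1) : ‖poincareToKleinFun x‖ < 1 := by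
  rw [norm_poincareToKleinFun, div_lt_one (by positivity)]
  nlinarith [sq_pos_of_pos (sub_pos.2 hx)]

theorem norm_kleinToPoincareFun_lt_one {X : E} (hX : ‖X‖ < 1) : ‖kleinToPoincareFun X‖ < 1 := by
  rw [norm_kleinToPoincareFun, div_lt_one (by positivity)]
  exact hX.trans_le (le_add_of_nonneg_right (Real.sqrt_nonneg _))

theorem kleinToPoincareFun_poincareToKleinFun {x : E} (hx : ‖x‖ < 1) :
    kleinToPoincareFun (poincareToKleinFun x) = x := by
  have hsq : 1 - ‖poincareToKleinFun x‖ ^ 2 = ((1 - ‖x‖ ^ 2) / (1 + ‖x‖ ^ 2)) ^ 2 := by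
    rw [norm_poincareToKleinFun]
    field_simp
    ring
  have hnonneg : 0 ≤ (1 - ‖x‖ ^ 2) / (1 + ‖x‖ ^ 2) :=
    div_nonneg (sub_nonneg.2 (pow_le_one₀ (norm_nonneg x) hx.le)) (by positivity)
  rw [kleinToPoincareFun, hsq, Real.sqrt_sq hnonneg, poincareToKleinFun, smul_smul]
  convert one_smul ℝ x using 2
  field_simp
  ring

theorem poincareToKleinFun_kleinToPoincareFun {X : E} (hX : ‖X‖ < 1) :
    poincareToKleinFun (kleinToPoincareFun X) = X := by
  rw [poincareToKleinFun, norm_kleinToPoincareFun, kleinToPoincareFun, smul_smul]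
  have hsq : ‖X‖ ^ 2 = 1 - √(1 - ‖X‖ ^ 2) ^ 2 := by
    rw [Real.sq_sqrt (sub_nonneg.2 (pow_le_one₀ (norm_nonneg X) hX.le))]
    ring
  have hnonneg := Real.sqrt_nonneg (1 - ‖X‖ ^ 2)
  set S := √(1 - ‖X‖ ^ 2)
  have hden : 1 + (‖X‖ / (1 + S)) ^ 2 = 2 / (1 + S) := by
    rw [div_pow, hsq]
    field_simp
    ring
  rw [hden]
  convert one_smul ℝ X using 2
  field_simp

theorem continuous_poincareToKleinFun : Continuous (poincareToKleinFun (E := E)) :=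
  .smul (f := fun x : E => 2 / (1 + ‖x‖ ^ 2))
    (.div (by fun_prop) (by fun_prop) fun x => by positivity) continuous_id

theorem continuous_kleinToPoincareFun : Continuous (kleinToPoincareFun (E := E)) :=
  .smul (f := fun X : E => 1 / (1 + √(1 - ‖X‖ ^ 2)))
    (.div (by fun_prop) (by fun_prop) fun X => by positivity) continuous_id

variable (E) in
/-- The homeomorphism `x ↦ 2x / (1 + |x|²)` of the open unit ball. -/
def poincareToKlein : OpenPartialHomeomorph E E where
  toFun := poincareToKleinFun
  invFun := kleinToPoincareFun
  source := Metric.ball 0 1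
  target := Metric.ball 0 1
  map_source' x hx := by
    rw [mem_ball_zero_iff] at hx ⊢
    exact norm_poincareToKleinFun_lt_one hx
  map_target' X hX := by
    rw [mem_ball_zero_iff] at hX ⊢
    exact norm_kleinToPoincareFun_lt_one hX
  left_inv' _ hx := kleinToPoincareFun_poincareToKleinFun (mem_ball_zero_iff.1 hx)
  right_inv' _ hX := poincareToKleinFun_kleinToPoincareFun (mem_ball_zero_iff.1 hX)
  open_source := Metric.isOpen_ball
  open_target := Metric.isOpen_ball
  continuousOn_toFun := continuous_poincareToKleinFun.continuousOn
  continuousOn_invFun := continuous_kleinToPoincareFun.continuousOn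

end NormedSpace

variable {E : Type*} [NormedAddCommGroup E] [InnerProductSpace ℝ E]

theorem contDiffOn_poincareToKlein : ContDiffOn ℝ ∞ (poincareToKlein E) (Metric.ball 0 1) :=
  .smul (f := fun x : E => 2 / (1 + ‖x‖ ^ 2))
    (.div contDiffOn_const (contDiffOn_const.add (contDiff_norm_sq ℝ).contDiffOn)
      fun x _ => by positivity) contDiffOn_id

theorem contDiffOn_poincareToKlein_symm :
    ContDiffOn ℝ ∞ (poincareToKlein E).symm (Metric.ball 0 1) :=
  .smul (f := fun X : E => 1 / (1 + √(1 - ‖X‖ ^ 2)))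
    (.div contDiffOn_const (contDiffOn_const.add (.sqrt
      (contDiffOn_const.sub (contDiff_norm_sq ℝ).contDiffOn) fun X hX =>
        (sub_pos.2 (pow_lt_one₀ (norm_nonneg X) (mem_ball_zero_iff.1 hX) two_ne_zero)).ne'))
      fun X _ => by positivity) contDiffOn_id

end PoincareToKlein

/-! ### Binary forms and their isotropic vectors -/

theorem two_mul_eq_add_conj_mul_sq_iff {w q : ℂ} (hq : ‖q‖ < 1) :
    2 * q = w + conj w * q ^ 2 ↔ poincareToKlein ℂ q = w := by
  have hnormSq : conj q * q = ((‖q‖ ^ 2 : ℝ) : ℂ) := by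
    rw [Complex.conj_mul', Complex.ofReal_pow]
  have hpos : (1 + ‖q‖ ^ 2 : ℂ) ≠ 0 := by exact_mod_cast (by positivity : (0 : ℝ) < _).ne'
  have hneg : (1 - ‖q‖ ^ 2 : ℂ) ≠ 0 := by
    exact_mod_cast (sub_pos.2 (pow_lt_one₀ (norm_nonneg q) hq two_ne_zero)).ne'
  have hklein : poincareToKlein ℂ q = 2 * q / (1 + ‖q‖ ^ 2) := by
    change (2 / (1 + ‖q‖ ^ 2)) • q = _
    rw [Complex.real_smul]
    push_cast
    ring
  push_cast at hnormSq
  rw [hklein, div_eq_iff hpos]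
  constructor <;> intro h
  · have hconj : 2 * conj q = conj w + w * conj q ^ 2 := by
      have := congrArg conj h
      simpa only [map_mul, map_add, map_pow, map_ofNat, Complex.conj_conj] using this
    -- eliminating `conj w` leaves a multiple of `1 - |q|²`
    refine mul_left_cancel₀ hneg ?_
    linear_combination h - q ^ 2 * hconj + (2 * q - w * (conj q * q + ‖q‖ ^ 2)) * hnormSq
  · have hconj : 2 * conj q = conj w * (1 + ‖q‖ ^ 2) := by
      have := congrArg conj h
      simpa only [map_mul, map_add, map_pow, map_ofNat, map_one, Complex.conj_ofReal] using this
    refine mul_left_cancel₀ hpos ?_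
    linear_combination h + q ^ 2 * hconj - 2 * q * hnormSq

/-- The vector `u = ((1 + q)/2, i(q - 1)/2)`, determined by `u₁ + i u₂ = 1` and `u₁ - i u₂ = q`;
for `q = z zᵗ` the Hua transform is characterised by `𝓗(z) u = z`. -/
def planeVec (q : ℂ) : Fin 2 → ℂ := ![(1 + q) / 2, Complex.I * (q - 1) / 2]

theorem planeVec_dotProduct_self (q : ℂ) : planeVec q ⬝ᵥ planeVec q = q := by
  simp only [planeVec, dotProduct, Fin.sum_univ_two, Matrix.cons_val_zero, Matrix.cons_val_one]
  linear_combination (q - 1) ^ 2 / 4 * Complex.I_sq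

theorem star_planeVec_dotProduct_self (q : ℂ) :
    star (planeVec q) ⬝ᵥ planeVec q = ((1 + ‖q‖ ^ 2) / 2 : ℝ) := by
  simp only [planeVec, dotProduct, Fin.sum_univ_two, Pi.star_apply, Matrix.cons_val_zero,
    Matrix.cons_val_one, Complex.star_def, map_div₀, map_add, map_mul, map_sub, map_one,
    map_ofNat, Complex.conj_I]
  push_cast
  rw [← Complex.conj_mul']
  linear_combination -((conj q - 1) * (q - 1)) / 4 * Complex.I_sq

theorem planeVec_mul_conj_im (q : ℂ) :
    (planeVec q 0 * conj (planeVec q 1)).im = (1 - ‖q‖ ^ 2) / 4 := by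
  rw [← Complex.normSq_eq_norm_sq]
  simp [planeVec, Complex.normSq_apply, map_ofNat]
  ring

theorem posDef_iff_of_isotropic {P : Matrix (Fin 2) (Fin 2) ℝ} (hP : P.IsSymm) {u : Fin 2 → ℂ}
    (hu : (u 0 * conj (u 1)).im ≠ 0) (hnull : u ⬝ᵥ P.map Complex.ofReal *ᵥ u = 0) :
    P.PosDef ↔ 0 < (star u ⬝ᵥ P.map Complex.ofReal *ᵥ u).re := by
  let R : Matrix (Fin 2) (Fin 2) ℝ := !![(u 0).re, (u 0).im; (u 1).re, (u 1).im]
  have hR : IsUnit R := by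
    rw [Matrix.isUnit_iff_isUnit_det, isUnit_iff_ne_zero, Matrix.det_fin_two_of]
    intro hdet
    apply hu
    simp only [Complex.mul_im, Complex.conj_re, Complex.conj_im]
    linarith
  -- `P` is a multiple of the identity in the basis formed by the real and imaginary parts of `u`
  have hconj : star R * P * R =
      Matrix.diagonal fun _ => (star u ⬝ᵥ P.map Complex.ofReal *ᵥ u).re / 2 := by
    have hsymm : P 1 0 = P 0 1 := hP.apply 0 1
    have hre := congrArg Complex.re hnull
    have him := congrArg Complex.im hnull
    simp [Matrix.mulVec, dotProduct, hsymm] at hre him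
    ext i j
    fin_cases i <;> fin_cases j <;>
      simp [R, Matrix.mul_apply, Matrix.mulVec, dotProduct, hsymm, Matrix.star_apply] <;> linarith
  rw [← Matrix.IsUnit.posDef_star_left_conjugate_iff hR, hconj, Matrix.posDef_diagonal_iff]
  simp

theorem existsUnique_isotropic_planeVec {P : Matrix (Fin 2) (Fin 2) ℝ} (hP : P.PosDef) :
    ∃! q : ℂ, ‖q‖ < 1 ∧ planeVec q ⬝ᵥ P.map Complex.ofReal *ᵥ planeVec q = 0 := by
  have hsymm : P 1 0 = P 0 1 := hP.isHermitian.apply 0 1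
  have htr : 0 < P.trace := hP.trace_pos
  set w : ℂ := ⟨(P 1 1 - P 0 0) / P.trace, 2 * P 0 1 / P.trace⟩ with hw_def
  have hw : ‖w‖ < 1 := by
    have hdet := hP.det_pos
    rw [Matrix.det_fin_two, hsymm] at hdet
    rw [← sq_lt_one_iff₀ (norm_nonneg w), ← Complex.normSq_eq_norm_sq, Complex.normSq_mk,
      ← sub_pos]
    have hkey : 1 - ((P 1 1 - P 0 0) / P.trace * ((P 1 1 - P 0 0) / P.trace) +
        2 * P 0 1 / P.trace * (2 * P 0 1 / P.trace)) =
        4 * (P 0 0 * P 1 1 - P 0 1 * P 0 1) / P.trace ^ 2 := by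
      field_simp
      rw [Matrix.trace_fin_two]
      ring
    rw [hkey]
    positivity
  have hiff (q : ℂ) : planeVec q ⬝ᵥ P.map Complex.ofReal *ᵥ planeVec q = 0 ↔
      2 * q = w + conj w * q ^ 2 := by
    have hT : (P.trace : ℂ) ≠ 0 := Complex.ofReal_ne_zero.2 htr.ne'
    have hw' : w = (P 1 1 - P 0 0 + 2 * P 0 1 * Complex.I) / P.trace := by
      rw [hw_def, Complex.mk_eq_add_mul_I]
      push_cast
      ring
    have hvalue : planeVec q ⬝ᵥ P.map Complex.ofReal *ᵥ planeVec q =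
        P.trace / 4 * (2 * q - (w + conj w * q ^ 2)) := by
      simp only [hw', map_div₀, map_add, map_sub, map_mul, map_ofNat, Complex.conj_ofReal,
        Complex.conj_I]
      field_simp
      simp [planeVec, Matrix.mulVec, dotProduct, Matrix.trace_fin_two, hsymm]
      linear_combination P 1 1 * (q - 1) ^ 2 * Complex.I_sq
    rw [hvalue, mul_eq_zero, or_iff_right (div_ne_zero hT (by norm_num)), sub_eq_zero]
  have hmaps : ‖(poincareToKlein ℂ).symm w‖ < 1 := norm_kleinToPoincareFun_lt_one hw
  refine ⟨(poincareToKlein ℂ).symm w, ⟨hmaps, ?_⟩, fun q hq => ?_⟩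
  · rw [hiff, two_mul_eq_add_conj_mul_sq_iff hmaps]
    exact poincareToKleinFun_kleinToPoincareFun hw
  · rw [← (two_mul_eq_add_conj_mul_sq_iff hq.1).1 ((hiff q).1 hq.2)]
    exact (kleinToPoincareFun_poincareToKleinFun hq.1).symm

/-! ### The Hua transform -/

section Hua

variable {n : ℕ}

theorem norm_quad_le (z : EuclideanSpace ℂ (Fin n)) : ‖quad z‖ ≤ ‖z‖ ^ 2 := by
  rw [EuclideanSpace.norm_sq_eq, quad]
  exact (norm_sum_le _ _).trans_eq (by simp only [norm_pow])

theorem mem_lieBall_iff {z : EuclideanSpace ℂ (Fin n)} :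
    z ∈ lieBall n ↔ 0 < 1 - 2 * ‖z‖ ^ 2 + ‖quad z‖ ^ 2 ∧ ‖quad z‖ < 1 := by
  have hle := norm_quad_le z
  refine and_congr_right fun hpos =>
    ⟨fun hz => hle.trans_lt (pow_lt_one₀ (norm_nonneg z) hz two_ne_zero), fun hq => ?_⟩
  nlinarith [norm_nonneg z, norm_nonneg (quad z)]

theorem norm_quad_lt_one {z : EuclideanSpace ℂ (Fin n)} (hz : z ∈ lieBall n) : ‖quad z‖ < 1 :=
  (mem_lieBall_iff.1 hz).2

theorem quad_ofRealVec (x : EuclideanSpace ℝ (Fin n)) :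
    quad (ofRealVec x) = (‖x‖ ^ 2 : ℝ) := by
  simp [EuclideanSpace.norm_sq_eq, quad, ofRealVec]

theorem norm_ofRealVec (x : EuclideanSpace ℝ (Fin n)) : ‖ofRealVec x‖ = ‖x‖ := by
  simp [EuclideanSpace.norm_eq, ofRealVec]

theorem mem_lieBall_of_norm_quad_eq {z : EuclideanSpace ℂ (Fin n)} (hquad : ‖quad z‖ = ‖z‖ ^ 2)
    (hz : ‖z‖ < 1) : z ∈ lieBall n := by
  refine ⟨?_, hz⟩
  have hpos : 0 < 1 - ‖z‖ ^ 2 := sub_pos.2 (pow_lt_one₀ (norm_nonneg z) hz two_ne_zero)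
  rw [hquad]
  linarith [pow_pos hpos 2]

theorem ofRealVec_mem_lieBall_iff {x : EuclideanSpace ℝ (Fin n)} :
    ofRealVec x ∈ lieBall n ↔ ‖x‖ < 1 := by
  rw [← norm_ofRealVec x]
  refine ⟨And.right, mem_lieBall_of_norm_quad_eq ?_⟩
  rw [quad_ofRealVec, norm_ofRealVec, Complex.norm_real, Real.norm_of_nonneg (sq_nonneg _)]

/-- The vector `ν = (u, z)` of `ℂ²⁺ⁿ`, isotropic for the complexified form of signature `(2,n)`.
The line it spans is the point of the projective quadric that corresponds to `z`. -/
def isotropicLift (z : EuclideanSpace ℂ (Fin n)) : Fin 2 ⊕ Fin n → ℂ :=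
  Sum.elim (planeVec (quad z)) z

theorem formOver_isotropicLift (z : EuclideanSpace ℂ (Fin n)) :
    formOver ℂ (isotropicLift z) (isotropicLift z) = 0 := by
  have hquad : ∑ j, z j * z j = quad z := by simp only [quad, sq]
  exact (congrArg₂ _ (planeVec_dotProduct_self _) hquad).trans (sub_self _)

theorem formOver_star_isotropicLift (z : EuclideanSpace ℂ (Fin n)) :
    formOver ℂ (star (isotropicLift z)) (isotropicLift z) =
      ((1 - 2 * ‖z‖ ^ 2 + ‖quad z‖ ^ 2) / 2 : ℝ) := by
  have hnorm : ∑ j, conj (z j) * z j = (‖z‖ ^ 2 : ℝ) := by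
    simp only [EuclideanSpace.norm_sq_eq, Complex.conj_mul', Complex.ofReal_sum, Complex.ofReal_pow]
  refine (congrArg₂ _ (star_planeVec_dotProduct_self _) hnorm).trans ?_
  push_cast
  ring

theorem huaCoeff_eq (z : EuclideanSpace ℂ (Fin n)) :
    huaCoeff z = (2 : ℂ) • Matrix.of ![planeVec (quad z), star (planeVec (quad z))] := by
  ext i j
  fin_cases i <;> fin_cases j <;> simp [huaCoeff, planeVec] <;> ring

theorem huaCoeff_det_ne_zero {z : EuclideanSpace ℂ (Fin n)} (hq : ‖quad z‖ < 1) :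
    (huaCoeff z).det ≠ 0 := by
  have hdet : (huaCoeff z).det = 2 * Complex.I * (1 - ‖quad z‖ ^ 2 : ℝ) := by
    rw [huaCoeff, Matrix.det_fin_two_of]
    push_cast
    linear_combination -2 * Complex.I * Complex.conj_mul' (quad z)
  rw [hdet]
  exact mul_ne_zero (mul_ne_zero two_ne_zero Complex.I_ne_zero) (Complex.ofReal_ne_zero.2
    (sub_pos.2 (pow_lt_one₀ (norm_nonneg _) hq two_ne_zero)).ne')

theorem hua_eq_iff {z : EuclideanSpace ℂ (Fin n)} (hq : ‖quad z‖ < 1)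
    {Z : Matrix (Fin n) (Fin 2) ℝ} :
    hua z = Z ↔ Z.map Complex.ofReal *ᵥ planeVec (quad z) = z := by
  have hC := (huaCoeff_det_ne_zero hq).isUnit
  have hrows : huaComplex z = Z.map Complex.ofReal ↔
      huaRows z = Matrix.of ![planeVec (quad z), star (planeVec (quad z))] *
        (Z.map Complex.ofReal)ᵀ := by
    rw [huaComplex, ← Matrix.transpose_inj, Matrix.transpose_smul, Matrix.transpose_transpose]
    constructor <;> intro h
    · rw [← h, Matrix.mul_smul, ← Matrix.smul_mul, ← huaCoeff_eq, ← Matrix.mul_assoc,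
        Matrix.mul_nonsing_inv _ hC, Matrix.one_mul]
    · rw [h, ← Matrix.mul_smul, ← Matrix.smul_mul, ← huaCoeff_eq, ← Matrix.mul_assoc,
        Matrix.nonsing_inv_mul _ hC, Matrix.one_mul]
  have hinj : Function.Injective fun Z : Matrix (Fin n) (Fin 2) ℝ => Z.map Complex.ofReal :=
    Matrix.map_injective Complex.ofReal_injective
  have hrow_zero (j : Fin n) : (Matrix.of ![planeVec (quad z), star (planeVec (quad z))] *
      (Z.map Complex.ofReal)ᵀ) 0 j = (Z.map Complex.ofReal *ᵥ planeVec (quad z)) j := by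
    simp [Matrix.mul_apply, Matrix.mulVec, dotProduct, mul_comm]
  -- the second row is the conjugate of the first
  have hrow_one (j : Fin n) : (Matrix.of ![planeVec (quad z), star (planeVec (quad z))] *
      (Z.map Complex.ofReal)ᵀ) 1 j = conj ((Z.map Complex.ofReal *ᵥ planeVec (quad z)) j) := by
    simp [Matrix.mul_apply, Matrix.mulVec, dotProduct, mul_comm]
  rw [← hinj.eq_iff, ← huaComplex_eq_hua, hrows]
  refine ⟨fun h => funext fun j => ((congrFun₂ h 0 j).trans (hrow_zero j)).symm, fun h => ?_⟩
  ext i j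
  fin_cases i
  · exact (congrFun h j).symm.trans (hrow_zero j).symm
  · exact (congrArg conj (congrFun h j)).symm.trans (hrow_one j).symm

theorem isotropicLift_eq_graph {z : EuclideanSpace ℂ (Fin n)} (hq : ‖quad z‖ < 1) :
    isotropicLift z =
      Sum.elim (planeVec (quad z)) ((hua z).map Complex.ofReal *ᵥ planeVec (quad z)) := by
  rw [isotropicLift, (hua_eq_iff hq).1 rfl]

theorem map_one_sub_transpose_mul (Z : Matrix (Fin n) (Fin 2) ℝ) :
    (1 - Zᵀ * Z).map Complex.ofReal = 1 - (Z.map Complex.ofReal)ᵀ * Z.map Complex.ofReal := by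
  change Complex.ofRealHom.mapMatrix _ = _
  rw [map_sub, map_one]
  exact congrArg (1 - ·) Matrix.map_mul

theorem isotropic_planeVec_quad {z : EuclideanSpace ℂ (Fin n)} (hq : ‖quad z‖ < 1) :
    planeVec (quad z) ⬝ᵥ (1 - (hua z)ᵀ * hua z).map Complex.ofReal *ᵥ planeVec (quad z) = 0 := by
  rw [map_one_sub_transpose_mul, ← formOver_graph, ← isotropicLift_eq_graph hq,
    formOver_isotropicLift]

theorem hua_mem_matBall_iff {z : EuclideanSpace ℂ (Fin n)} (hq : ‖quad z‖ < 1) :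
    hua z ∈ matBall n ↔ z ∈ lieBall n := by
  have hsymm : (1 - (hua z)ᵀ * hua z).IsSymm := by
    simp [Matrix.IsSymm, Matrix.transpose_sub, Matrix.transpose_mul]
  have him : (planeVec (quad z) 0 * conj (planeVec (quad z) 1)).im ≠ 0 := by
    rw [planeVec_mul_conj_im]
    exact (div_pos (sub_pos.2 (pow_lt_one₀ (norm_nonneg _) hq two_ne_zero)) four_pos).ne'
  have hherm : star (planeVec (quad z)) ⬝ᵥ
      (1 - (hua z)ᵀ * hua z).map Complex.ofReal *ᵥ planeVec (quad z) =
      ((1 - 2 * ‖z‖ ^ 2 + ‖quad z‖ ^ 2) / 2 : ℝ) := by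
    rw [map_one_sub_transpose_mul, ← formOver_graph, ← formOver_star_isotropicLift,
      isotropicLift_eq_graph hq]
    congr 1
    ext (i | j) <;> simp [Matrix.mulVec, dotProduct]
  rw [matBall, Set.mem_ofPred_eq, posDef_iff_of_isotropic hsymm him (isotropic_planeVec_quad hq),
    hherm, Complex.ofReal_re, mem_lieBall_iff, and_iff_left hq]
  exact div_pos_iff_of_pos_right two_pos

theorem hua_mem_matBall {z : EuclideanSpace ℂ (Fin n)} (hz : z ∈ lieBall n) :
    hua z ∈ matBall n :=
  (hua_mem_matBall_iff (norm_quad_lt_one hz)).2 hz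

theorem hua_injOn : Set.InjOn hua (lieBall n) := by
  intro z hz w hw hzw
  have hqz := norm_quad_lt_one hz
  have hqw := norm_quad_lt_one hw
  have hquad : quad z = quad w :=
    (existsUnique_isotropic_planeVec (hua_mem_matBall hz)).unique
      ⟨hqz, isotropic_planeVec_quad hqz⟩ ⟨hqw, by rw [hzw, isotropic_planeVec_quad hqw]⟩
  refine WithLp.ofLp_injective 2 ?_
  rw [← (hua_eq_iff hqz).1 hzw, ← (hua_eq_iff hqw).1 rfl, hquad]

theorem hua_surjOn : Set.SurjOn hua (lieBall n) (matBall n) := by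
  intro Z hZ
  obtain ⟨q, ⟨hq, hnull⟩, -⟩ := existsUnique_isotropic_planeVec hZ
  set z : EuclideanSpace ℂ (Fin n) := WithLp.toLp 2 (Z.map Complex.ofReal *ᵥ planeVec q) with hz
  have hquad : quad z = q := by
    rw [map_one_sub_transpose_mul, ← formOver_graph] at hnull
    calc quad z = (Z.map Complex.ofReal *ᵥ planeVec q) ⬝ᵥ (Z.map Complex.ofReal *ᵥ planeVec q) := by
          simp only [quad, hz, sq, dotProduct]
      _ = planeVec q ⬝ᵥ planeVec q := (sub_eq_zero.1 hnull).symm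
      _ = q := planeVec_dotProduct_self q
  rw [← hquad] at hq
  have hhua : hua z = Z := (hua_eq_iff hq).2 (by rw [hquad])
  exact ⟨z, (hua_mem_matBall_iff hq).1 (hhua ▸ hZ), hhua⟩

theorem hua_bijOn : Set.BijOn hua (lieBall n) (matBall n) :=
  ⟨fun _ => hua_mem_matBall, hua_injOn, hua_surjOn⟩

theorem hua_ofRealVec {x : EuclideanSpace ℝ (Fin n)} (hx : ‖x‖ < 1) :
    hua (ofRealVec x) = colZero (poincareToKlein _ x) := by
  rw [hua_eq_iff (norm_quad_lt_one (ofRealVec_mem_lieBall_iff.2 hx)), quad_ofRealVec]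
  have hden : ((1 + ‖x‖ ^ 2 : ℝ) : ℂ) ≠ 0 := Complex.ofReal_ne_zero.2 (by positivity)
  ext j
  change _ = (x j : ℂ)
  have hklein : poincareToKlein _ x j = 2 / (1 + ‖x‖ ^ 2) * x j := rfl
  simp only [Matrix.mulVec, dotProduct, Fin.sum_univ_two, colZero, planeVec, Matrix.map_apply,
    Matrix.of_apply, Matrix.cons_val_zero, Matrix.cons_val_one, hklein]
  push_cast at hden ⊢
  field_simp
  ring

theorem hua_image_realPart :
    hua '' realPart n = {Z | ∃ X : EuclideanSpace ℝ (Fin n), ‖X‖ < 1 ∧ Z = colZero X} := by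
  ext Z
  constructor
  · rintro ⟨_, ⟨hx, x, rfl⟩, rfl⟩
    have hx := ofRealVec_mem_lieBall_iff.1 hx
    exact ⟨_, norm_poincareToKleinFun_lt_one hx, hua_ofRealVec hx⟩
  · rintro ⟨X, hX, rfl⟩
    have hx := norm_kleinToPoincareFun_lt_one hX
    refine ⟨_, ⟨ofRealVec_mem_lieBall_iff.2 hx, _, rfl⟩, (hua_ofRealVec hx).trans ?_⟩
    exact congrArg colZero (poincareToKleinFun_kleinToPoincareFun hX)

end Hua

/-! ### The linear action on isotropic lines -/

section Action

variable {n : ℕ}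

/-- The cone over the Lie ball: isotropic vectors on which the Hermitian form of signature `(2,n)`
is positive and whose first two coordinates are positively oriented, which singles out one of the
two connected components. -/
def lieCone (n : ℕ) : Set (Fin 2 ⊕ Fin n → ℂ) :=
  {v | formOver ℂ v v = 0 ∧ 0 < (formOver ℂ (star v) v).re ∧
    0 < (v (Sum.inl 0) * conj (v (Sum.inl 1))).im}

/-- The linear form `v₁ + i v₂`; dividing an isotropic vector by it normalises the vector to the
form `isotropicLift z`. -/
def homFactor (v : Fin 2 ⊕ Fin n → ℂ) : ℂ := v (Sum.inl 0) + Complex.I * v (Sum.inl 1)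

/-- The point `z` represented by the isotropic line through `v`, in the affine chart
`v₁ + i v₂ = 1`. -/
def ofIsotropic (v : Fin 2 ⊕ Fin n → ℂ) : EuclideanSpace ℂ (Fin n) :=
  WithLp.toLp 2 fun j => (homFactor v)⁻¹ * v (Sum.inr j)

theorem isotropicLift_mem_lieCone_iff {z : EuclideanSpace ℂ (Fin n)} :
    isotropicLift z ∈ lieCone n ↔ z ∈ lieBall n := by
  rw [lieCone, Set.mem_ofPred_eq, and_iff_right (formOver_isotropicLift z),
    formOver_star_isotropicLift, Complex.ofReal_re, div_pos_iff_of_pos_right two_pos,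
    isotropicLift, Sum.elim_inl, Sum.elim_inl, planeVec_mul_conj_im,
    div_pos_iff_of_pos_right four_pos, sub_pos, sq_lt_one_iff₀ (norm_nonneg _), mem_lieBall_iff]

theorem smul_mem_lieCone_iff {c : ℂ} (hc : c ≠ 0) {v : Fin 2 ⊕ Fin n → ℂ} :
    c • v ∈ lieCone n ↔ v ∈ lieCone n := by
  have hc_sq : conj c * c = (Complex.normSq c : ℝ) := (Complex.normSq_eq_conj_mul_self).symm
  have hform (a b : ℂ) (x y : Fin 2 ⊕ Fin n → ℂ) :
      formOver ℂ (a • x) (b • y) = a * b * formOver ℂ x y := by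
    simp only [formOver, Pi.smul_apply, smul_eq_mul, mul_sub, Finset.mul_sum]
    congr! 2 <;> ring
  have horient : (c • v) (Sum.inl 0) * conj ((c • v) (Sum.inl 1)) =
      (Complex.normSq c : ℝ) * (v (Sum.inl 0) * conj (v (Sum.inl 1))) := by
    simp only [Pi.smul_apply, smul_eq_mul, map_mul, ← hc_sq]
    ring
  have hpos := Complex.normSq_pos.2 hc
  simp only [lieCone, Set.mem_ofPred_eq, star_smul, Complex.star_def, hform, horient, hc_sq,
    Complex.re_ofReal_mul, Complex.im_ofReal_mul, mul_eq_zero, hc, false_or,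
    mul_pos_iff_of_pos_left hpos]

theorem homFactor_ne_zero {v : Fin 2 ⊕ Fin n → ℂ} (hv : v ∈ lieCone n) : homFactor v ≠ 0 := by
  intro hzero
  have hv₀ : v (Sum.inl 0) = -Complex.I * v (Sum.inl 1) := by
    rw [homFactor] at hzero
    linear_combination hzero
  have him := hv.2.2
  rw [hv₀, mul_assoc, Complex.mul_conj, neg_mul, Complex.neg_im, Complex.I_mul_im,
    Complex.ofReal_re, neg_pos] at him
  exact (Complex.normSq_nonneg _).not_gt him

theorem homFactor_isotropicLift (z : EuclideanSpace ℂ (Fin n)) :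
    homFactor (isotropicLift z) = 1 := by
  simp only [homFactor, isotropicLift, planeVec, Sum.elim_inl, Matrix.cons_val_zero,
    Matrix.cons_val_one]
  linear_combination (quad z - 1) / 2 * Complex.I_sq

theorem homFactor_smul (c : ℂ) (v : Fin 2 ⊕ Fin n → ℂ) :
    homFactor (c • v) = c * homFactor v := by
  simp only [homFactor, Pi.smul_apply, smul_eq_mul]
  ring

theorem ofIsotropic_smul {c : ℂ} (hc : c ≠ 0) (v : Fin 2 ⊕ Fin n → ℂ) :
    ofIsotropic (c • v) = ofIsotropic v := by
  ext j
  simp only [ofIsotropic, homFactor_smul, Pi.smul_apply, smul_eq_mul]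
  field_simp

theorem ofIsotropic_isotropicLift (z : EuclideanSpace ℂ (Fin n)) :
    ofIsotropic (isotropicLift z) = z := by
  ext j
  simp only [ofIsotropic, homFactor_isotropicLift, inv_one, one_mul]
  rfl

theorem homFactor_smul_isotropicLift {v : Fin 2 ⊕ Fin n → ℂ} (hv : v ∈ lieCone n) :
    homFactor v • isotropicLift (ofIsotropic v) = v := by
  have hf := homFactor_ne_zero hv
  -- isotropy reads `∑ vⱼ² = (v₁ + i v₂)(v₁ - i v₂)`
  have hquad : homFactor v * quad (ofIsotropic v) =
      v (Sum.inl 0) - Complex.I * v (Sum.inl 1) := by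
    have hnull : ∑ j, v (Sum.inr j) ^ 2 = v (Sum.inl 0) ^ 2 + v (Sum.inl 1) ^ 2 := by
      simpa only [formOver, ← sq, Fin.sum_univ_two] using (sub_eq_zero.1 hv.1).symm
    simp only [quad, ofIsotropic, mul_pow, ← Finset.mul_sum, hnull]
    field_simp
    rw [homFactor]
    linear_combination v (Sum.inl 1) ^ 2 * Complex.I_sq
  ext k
  simp only [isotropicLift, Pi.smul_apply, smul_eq_mul]
  rcases k with k | j
  · fin_cases k
    · change homFactor v * ((1 + quad _) / 2) = v (Sum.inl 0)
      rw [mul_div_assoc', mul_add, hquad, homFactor]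
      ring
    · change homFactor v * (Complex.I * (quad _ - 1) / 2) = v (Sum.inl 1)
      rw [mul_div_assoc', mul_left_comm, mul_sub, hquad, homFactor]
      linear_combination -v (Sum.inl 1) * Complex.I_sq
  · exact mul_inv_cancel_left₀ hf _

theorem ofIsotropic_mem_lieBall {v : Fin 2 ⊕ Fin n → ℂ} (hv : v ∈ lieCone n) :
    ofIsotropic v ∈ lieBall n := by
  rw [← isotropicLift_mem_lieCone_iff, ← smul_mem_lieCone_iff (homFactor_ne_zero hv),
    homFactor_smul_isotropicLift hv]
  exact hv

theorem differentiable_quad : Differentiable ℂ (quad (n := n)) := by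
  unfold quad
  fun_prop

theorem differentiable_isotropicLift : Differentiable ℂ (isotropicLift (n := n)) := by
  have hquad := differentiable_quad (n := n)
  refine differentiable_pi.2 fun k => ?_
  rcases k with k | j
  · fin_cases k
    · change Differentiable ℂ fun z : EuclideanSpace ℂ (Fin n) => (1 + quad z) / 2
      fun_prop
    · change Differentiable ℂ fun z : EuclideanSpace ℂ (Fin n) => Complex.I * (quad z - 1) / 2
      fun_prop
  · exact differentiable_euclidean.1 differentiable_id j

theorem differentiableOn_ofIsotropic : DifferentiableOn ℂ (ofIsotropic (n := n)) (lieCone n) := by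
  have hfactor : Differentiable ℂ (homFactor (n := n)) := by
    unfold homFactor
    fun_prop
  refine (differentiableOn_piLp 2).2 fun j => ?_
  exact (hfactor.differentiableOn.inv fun _ => homFactor_ne_zero).mul (by fun_prop)

/-- A real matrix maps the cone over the Lie ball to itself. -/
def PreservesLieCone (g : Matrix (Fin 2 ⊕ Fin n) (Fin 2 ⊕ Fin n) ℝ) : Prop :=
  Set.MapsTo (g.map Complex.ofRealHom *ᵥ ·) (lieCone n) (lieCone n)

/-- The action of real matrices of size `2 + n` on the Lie ball induced by their linear action on
isotropic lines. -/
def act (g : Matrix (Fin 2 ⊕ Fin n) (Fin 2 ⊕ Fin n) ℝ) (z : EuclideanSpace ℂ (Fin n)) :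
    EuclideanSpace ℂ (Fin n) :=
  ofIsotropic (g.map Complex.ofRealHom *ᵥ isotropicLift z)

theorem act_one (z : EuclideanSpace ℂ (Fin n)) : act 1 z = z := by
  rw [act, Matrix.map_one _ (map_zero _) (map_one _), Matrix.one_mulVec, ofIsotropic_isotropicLift]

theorem mulVec_isotropicLift {g : Matrix (Fin 2 ⊕ Fin n) (Fin 2 ⊕ Fin n) ℝ}
    {z : EuclideanSpace ℂ (Fin n)} (hq : ‖quad z‖ < 1) :
    g.map Complex.ofRealHom *ᵥ isotropicLift z = Sum.elim
      ((g.toBlocks₁₁ + g.toBlocks₁₂ * hua z).map Complex.ofRealHom *ᵥ planeVec (quad z))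
      ((g.toBlocks₂₁ + g.toBlocks₂₂ * hua z).map Complex.ofRealHom *ᵥ planeVec (quad z)) := by
  rw [isotropicLift_eq_graph hq]
  refine (mulVec_graph _ _ _).trans ?_
  rw [Matrix.map_add _ (map_add _), Matrix.map_add _ (map_add _), Matrix.map_mul, Matrix.map_mul]
  rfl

theorem im_mulVec_mul_conj (N : Matrix (Fin 2) (Fin 2) ℝ) (u : Fin 2 → ℂ) :
    ((N.map Complex.ofRealHom *ᵥ u) 0 * conj ((N.map Complex.ofRealHom *ᵥ u) 1)).im =
      N.det * (u 0 * conj (u 1)).im := by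
  simp [Matrix.mulVec, dotProduct, Matrix.det_fin_two]
  ring

namespace PreservesLieCone

variable {g : Matrix (Fin 2 ⊕ Fin n) (Fin 2 ⊕ Fin n) ℝ} {z : EuclideanSpace ℂ (Fin n)}

theorem mulVec_isotropicLift_mem (hg : PreservesLieCone g) (hz : z ∈ lieBall n) :
    g.map Complex.ofRealHom *ᵥ isotropicLift z ∈ lieCone n :=
  hg (isotropicLift_mem_lieCone_iff.2 hz)

theorem act_mem_lieBall (hg : PreservesLieCone g) (hz : z ∈ lieBall n) : act g z ∈ lieBall n :=
  ofIsotropic_mem_lieBall (hg.mulVec_isotropicLift_mem hz)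

theorem homFactor_smul_isotropicLift_act (hg : PreservesLieCone g) (hz : z ∈ lieBall n) :
    homFactor (g.map Complex.ofRealHom *ᵥ isotropicLift z) • isotropicLift (act g z) =
      g.map Complex.ofRealHom *ᵥ isotropicLift z :=
  homFactor_smul_isotropicLift (hg.mulVec_isotropicLift_mem hz)

theorem act_mul (hg : PreservesLieCone g) (h : Matrix (Fin 2 ⊕ Fin n) (Fin 2 ⊕ Fin n) ℝ)
    (hz : z ∈ lieBall n) : act (h * g) z = act h (act g z) := by
  rw [act, Matrix.map_mul, ← Matrix.mulVec_mulVec, ← hg.homFactor_smul_isotropicLift_act hz,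
    Matrix.mulVec_smul, ofIsotropic_smul (homFactor_ne_zero (hg.mulVec_isotropicLift_mem hz))]
  rfl

theorem differentiableOn_act (hg : PreservesLieCone g) : DifferentiableOn ℂ (act g) (lieBall n) :=
  differentiableOn_ofIsotropic.comp
    ((g.map Complex.ofRealHom).mulVecLin.toContinuousLinearMap.differentiable.comp
      differentiable_isotropicLift).differentiableOn fun _ => hg.mulVec_isotropicLift_mem

theorem continuousOn_act : ContinuousOn
    (fun p : Matrix (Fin 2 ⊕ Fin n) (Fin 2 ⊕ Fin n) ℝ × EuclideanSpace ℂ (Fin n) => act p.1 p.2)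
    ({g | PreservesLieCone g} ×ˢ lieBall n) :=
  differentiableOn_ofIsotropic.continuousOn.comp (f := fun _ => _)
    ((continuous_fst.matrix_map Complex.continuous_ofReal).matrix_mulVec
      (differentiable_isotropicLift.continuous.comp continuous_snd)).continuousOn
    fun _ hp => hp.1.mulVec_isotropicLift_mem hp.2

theorem hua_act {g : SO 2 n} (hg : PreservesLieCone (soMat g)) (hz : z ∈ lieBall n) :
    hua (act (soMat g) z) = mobius g (hua z) := by
  have hq := norm_quad_lt_one hz
  rw [hua_eq_iff (norm_quad_lt_one (hg.act_mem_lieBall hz)), mobius]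
  set N := (soMat g).toBlocks₁₁ + (soMat g).toBlocks₁₂ * hua z
  set M := (soMat g).toBlocks₂₁ + (soMat g).toBlocks₂₂ * hua z
  have hlift := hg.homFactor_smul_isotropicLift_act hz
  have hf := homFactor_ne_zero (hg.mulVec_isotropicLift_mem hz)
  rw [mulVec_isotropicLift hq] at hlift hf
  set f := homFactor (Sum.elim (N.map Complex.ofRealHom *ᵥ planeVec (quad z))
    (M.map Complex.ofRealHom *ᵥ planeVec (quad z)))
  have hplane : f • planeVec (quad (act (soMat g) z)) =
      N.map Complex.ofRealHom *ᵥ planeVec (quad z) :=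
    funext fun i => congrFun hlift (Sum.inl i)
  have hcoord : f • ⇑(act (soMat g) z) = M.map Complex.ofRealHom *ᵥ planeVec (quad z) :=
    funext fun j => congrFun hlift (Sum.inr j)
  have hN : IsUnit N.det :=
    (PreservesForm.det_mobiusDenominator_ne_zero g.2 (hua_mem_matBall hz)).isUnit
  refine smul_right_injective _ hf ?_
  change f • ((M * N⁻¹).map Complex.ofRealHom *ᵥ _) = f • ⇑(act (soMat g) z)
  rw [← Matrix.mulVec_smul, hplane, hcoord, Matrix.mulVec_mulVec, ← Matrix.map_mul,
    Matrix.nonsing_inv_mul_cancel_right _ _ hN]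

end PreservesLieCone

end Action

/-! ### Orthochronous matrices -/

section Orthochronous

variable {n : ℕ}

theorem smul_mem_matBall {Z : Matrix (Fin n) (Fin 2) ℝ} (hZ : Z ∈ matBall n) {t : ℝ}
    (ht : t ∈ Set.Icc (0 : ℝ) 1) : t • Z ∈ matBall n := by
  have hsum : 1 - (t • Z)ᵀ * (t • Z) = (1 - Zᵀ * Z) + (1 - t ^ 2) • (Zᵀ * Z) := by
    rw [Matrix.transpose_smul, Matrix.smul_mul, Matrix.mul_smul, smul_smul, ← sq, sub_smul,
      one_smul]
    abel
  rw [matBall, Set.mem_ofPred_eq, hsum]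
  exact hZ.add_posSemidef ((Matrix.posSemidef_conjTranspose_mul_self Z).smul
    (sub_nonneg.2 (pow_le_one₀ ht.1 ht.2)))

theorem PreservesForm.det_mobiusDenominator_pos {g : Matrix (Fin 2 ⊕ Fin n) (Fin 2 ⊕ Fin n) ℝ}
    (hg : PreservesForm g) (hdet : 0 < g.toBlocks₁₁.det) {Z : Matrix (Fin n) (Fin 2) ℝ}
    (hZ : Z ∈ matBall n) : 0 < (g.toBlocks₁₁ + g.toBlocks₁₂ * Z).det := by
  have hcont : Continuous fun t : ℝ => (g.toBlocks₁₁ + g.toBlocks₁₂ * t • Z).det := by fun_prop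
  simpa using pos_of_isPreconnected isPreconnected_Icc hcont.continuousOn
    (fun t ht => hg.det_mobiusDenominator_ne_zero (smul_mem_matBall hZ ht))
    (Set.left_mem_Icc.2 zero_le_one) (Set.right_mem_Icc.2 zero_le_one) (by simpa using hdet)

theorem PreservesForm.preservesLieCone_of_det_pos
    {g : Matrix (Fin 2 ⊕ Fin n) (Fin 2 ⊕ Fin n) ℝ} (hg : PreservesForm g)
    (hdet : 0 < g.toBlocks₁₁.det) : PreservesLieCone g := by
  intro v hv
  have hz := ofIsotropic_mem_lieBall hv
  rw [← homFactor_smul_isotropicLift hv]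
  set z := ofIsotropic v
  dsimp only
  rw [Matrix.mulVec_smul, smul_mem_lieCone_iff (homFactor_ne_zero hv)]
  have hν := isotropicLift_mem_lieCone_iff.2 hz
  have hstar : star (g.map Complex.ofRealHom *ᵥ isotropicLift z) =
      g.map Complex.ofRealHom *ᵥ star (isotropicLift z) := by
    ext k
    simp [Matrix.mulVec, dotProduct]
  refine ⟨(hg.formOver_map_mulVec _ _ _).trans hν.1, ?_, ?_⟩
  · rw [hstar, hg.formOver_map_mulVec]
    exact hν.2.1
  · rw [mulVec_isotropicLift (norm_quad_lt_one hz), Sum.elim_inl, Sum.elim_inl, im_mulVec_mul_conj]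
    exact mul_pos (hg.det_mobiusDenominator_pos hdet (hua_mem_matBall hz)) hν.2.2

theorem zero_mem_lieBall : (0 : EuclideanSpace ℂ (Fin n)) ∈ lieBall n := by
  simp [lieBall, quad]

theorem PreservesLieCone.det_pos {g : Matrix (Fin 2 ⊕ Fin n) (Fin 2 ⊕ Fin n) ℝ}
    (hg : PreservesLieCone g) : 0 < g.toBlocks₁₁.det := by
  have hq := norm_quad_lt_one (zero_mem_lieBall (n := n))
  have hhua : hua (0 : EuclideanSpace ℂ (Fin n)) = 0 := (hua_eq_iff hq).2 (by simp)
  have hν := isotropicLift_mem_lieCone_iff.2 (zero_mem_lieBall (n := n))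
  have him := (hg hν).2.2
  dsimp only at him
  rw [mulVec_isotropicLift hq, hhua, Matrix.mul_zero, add_zero, Sum.elim_inl, Sum.elim_inl,
    im_mulVec_mul_conj] at him
  exact (pos_iff_pos_of_mul_pos him).2 hν.2.2

/-- A real matrix of any determinant belongs to the subgroup of `O(2,n)` that acts on the Lie ball:
it preserves the form and does not exchange the two components of the set of lines of which the
Lie ball is one. -/
structure IsOrthochronous (g : Matrix (Fin 2 ⊕ Fin n) (Fin 2 ⊕ Fin n) ℝ) : Prop where
  preservesForm : PreservesForm g
  preservesLieCone : PreservesLieCone g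

namespace IsOrthochronous

variable {g h : Matrix (Fin 2 ⊕ Fin n) (Fin 2 ⊕ Fin n) ℝ}

theorem iff_det_pos : IsOrthochronous g ↔ PreservesForm g ∧ 0 < g.toBlocks₁₁.det :=
  ⟨fun hg => ⟨hg.1, hg.2.det_pos⟩, fun hg => ⟨hg.1, hg.1.preservesLieCone_of_det_pos hg.2⟩⟩

protected theorem mul (hg : IsOrthochronous g) (hh : IsOrthochronous h) :
    IsOrthochronous (g * h) := by
  refine ⟨hg.1.mul hh.1, fun v hv => ?_⟩
  dsimp only
  rw [Matrix.map_mul, ← Matrix.mulVec_mulVec]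
  exact hg.2 (hh.2 hv)

protected theorem inv (hg : IsOrthochronous g) : IsOrthochronous g⁻¹ := by
  refine iff_det_pos.2 ⟨hg.1.inv, ?_⟩
  have hblock : g⁻¹.toBlocks₁₁ = g.toBlocks₁₁ᵀ := by
    rw [hg.1.inv_eq]
    ext i j
    simp [LieAlgebra.Orthogonal.indefiniteDiagonal, Matrix.toBlocks₁₁]
  rw [hblock, Matrix.det_transpose]
  exact hg.2.det_pos

/-- The automorphism of the Lie ball induced by an orthochronous matrix. -/
def toAut (hg : IsOrthochronous g) : aut n where
  val :=
    { toFun := fun z => ⟨act g z, hg.2.act_mem_lieBall z.2⟩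
      invFun := fun z => ⟨act g⁻¹ z, hg.inv.2.act_mem_lieBall z.2⟩
      left_inv := fun z => Subtype.ext <| by
        change act g⁻¹ (act g z) = z
        rw [← hg.2.act_mul _ z.2, Matrix.nonsing_inv_mul _ hg.1.isUnit_det, act_one]
      right_inv := fun z => Subtype.ext <| by
        change act g (act g⁻¹ z) = z
        rw [← hg.inv.2.act_mul _ z.2, Matrix.mul_nonsing_inv _ hg.1.isUnit_det, act_one]
      continuous_toFun := hg.2.differentiableOn_act.continuousOn.domRestrict.subtype_mk _
      continuous_invFun := hg.inv.2.differentiableOn_act.continuousOn.domRestrict.subtype_mk _ }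
  property := ⟨⟨act g, hg.2.differentiableOn_act, fun _ => rfl⟩,
    ⟨act g⁻¹, hg.inv.2.differentiableOn_act, fun _ => rfl⟩⟩

theorem toAut_mul (hg : IsOrthochronous g) (hh : IsOrthochronous h) :
    (hg.mul hh).toAut = hg.toAut * hh.toAut :=
  Subtype.ext <| Homeomorph.ext fun z => Subtype.ext <| hh.2.act_mul g z.2

theorem toAut_inv (hg : IsOrthochronous g) : hg.inv.toAut = hg.toAut⁻¹ :=
  Subtype.ext <| Homeomorph.ext fun _ => rfl

theorem of_mem_SOZero {g : SO 2 n} (hg : g ∈ SOZero 2 n) : IsOrthochronous (soMat g) := by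
  refine iff_det_pos.2 ⟨g.2, ?_⟩
  have hcont : Continuous fun g : SO 2 n => (soMat g).toBlocks₁₁.det :=
    (isEmbedding_soMat.continuous.matrix_submatrix Sum.inl Sum.inl).matrix_det
  have hdet_one : (soMat (1 : SO 2 n)).toBlocks₁₁.det = 1 := by
    change (Matrix.submatrix (1 : Matrix (Fin 2 ⊕ Fin n) (Fin 2 ⊕ Fin n) ℝ) Sum.inl Sum.inl).det = 1
    rw [Matrix.submatrix_one _ Sum.inl_injective, Matrix.det_one]
  refine pos_of_isPreconnected isPreconnected_connectedComponent hcont.continuousOn (fun g _ => ?_)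
    mem_connectedComponent hg (hdet_one ▸ one_pos)
  have hpos : (1 - (0 : Matrix (Fin n) (Fin 2) ℝ)ᵀ * (0 : Matrix (Fin n) (Fin 2) ℝ)).PosDef := by
    simpa only [Matrix.mul_zero, sub_zero] using Matrix.PosDef.one
  simpa only [Matrix.mul_zero, add_zero] using
    PreservesForm.det_mobiusDenominator_ne_zero (g := soMat g) g.2 hpos

end IsOrthochronous

/-- The action of `SO₀(2,n)` on the Lie ball. -/
def actionHom (n : ℕ) : SOZero 2 n →* aut n where
  toFun g := (IsOrthochronous.of_mem_SOZero g.2).toAut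
  map_one' := Subtype.ext <| Homeomorph.ext fun _ => Subtype.ext <| act_one _
  map_mul' g h := IsOrthochronous.toAut_mul (.of_mem_SOZero g.2) (.of_mem_SOZero h.2)

theorem hua_actionHom (g : SOZero 2 n) (z : lieBall n) :
    hua ((actionHom n g).1 z) = mobius g.1 (hua z) :=
  (IsOrthochronous.of_mem_SOZero g.2).2.hua_act z.2

theorem continuous_actionHom (n : ℕ) : Continuous (actionHom n) := by
  refine continuous_induced_rng.2 (ContinuousMap.continuous_of_continuous_uncurry _ ?_)
  exact .subtype_mk (f := fun p : SOZero 2 n × lieBall n => act (soMat p.1.1) p.2)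
    (PreservesLieCone.continuousOn_act.comp_continuous
      (f := fun p : SOZero 2 n × lieBall n => (soMat p.1.1, (p.2 : EuclideanSpace ℂ (Fin n))))
      ((isEmbedding_soMat.continuous.comp (continuous_subtype_val.comp continuous_fst)).prodMk
        (continuous_subtype_val.comp continuous_snd))
      fun p => ⟨(IsOrthochronous.of_mem_SOZero p.1.2).2, p.2.2⟩) _

end Orthochronous

/-! ### Holomorphic maps are determined by their values at real points -/

section IdentityTheorem

variable {G : Type*} [NormedAddCommGroup G] [NormedSpace ℂ G] [CompleteSpace G]

theorem eqOn_zero_of_starConvex {E : Type*} [NormedAddCommGroup E] [NormedSpace ℂ E] {U : Set E}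
    (hU : IsOpen U) (hstar : StarConvex ℝ 0 U) {F : E → G} (hF : DifferentiableOn ℂ F U)
    (hzero : F =ᶠ[nhds 0] 0) : Set.EqOn F 0 U := by
  intro z hz
  let line : ℂ →L[ℂ] E := ContinuousLinearMap.toSpanSingleton ℂ z
  have hline : Set.MapsTo line (line ⁻¹' U) U := fun _ hc => hc
  have hanalytic : AnalyticOnNhd ℂ (F ∘ line) (line ⁻¹' U) :=
    (hF.comp line.differentiableOn hline).analyticOnNhd (hU.preimage line.continuous)
  have hzero_mem : (0 : ℂ) ∈ line ⁻¹' U := by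
    simpa [line] using hstar.mem ⟨z, hz⟩
  have hconn : IsPreconnected (line ⁻¹' U) := by
    have hpre : StarConvex ℝ (0 : ℂ) (line ⁻¹' U) := by
      intro c hc s t hs ht hst
      simpa [line, mul_smul] using hstar hc hs ht hst
    exact (hpre.isPathConnected hzero_mem).isConnected.isPreconnected
  have hev : F ∘ line =ᶠ[nhds 0] 0 :=
    (line.continuous.tendsto' 0 0 (map_zero line)).eventually hzero
  simpa [line] using hanalytic.eqOn_zero_of_preconnected_of_eventuallyEq_zero hconn hzero_mem hev
    (show (1 : ℂ) ∈ line ⁻¹' U by simpa [line] using hz)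

theorem eqOn_zero_of_eq_zero_ofReal {U : Set ℂ} (hU : IsOpen U) (hconn : IsPreconnected U)
    {f : ℂ → G} (hf : DifferentiableOn ℂ f U) {t₀ : ℝ} (ht₀ : (t₀ : ℂ) ∈ U)
    (hzero : ∀ t : ℝ, (t : ℂ) ∈ U → f t = 0) : Set.EqOn f 0 U := by
  have htendsto : Filter.Tendsto Complex.ofReal (nhdsWithin t₀ {t₀}ᶜ)
      (nhdsWithin (t₀ : ℂ) {(t₀ : ℂ)}ᶜ) :=
    Complex.continuous_ofReal.continuousWithinAt.tendsto_nhdsWithin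
      fun t ht => Complex.ofReal_injective.ne ht
  have hev : ∀ᶠ t : ℝ in nhdsWithin t₀ {t₀}ᶜ, f t = 0 := by
    filter_upwards [nhdsWithin_le_nhds ((hU.preimage Complex.continuous_ofReal).mem_nhds ht₀)]
      with t ht using hzero t ht
  exact (hf.analyticOnNhd hU).eqOn_zero_of_preconnected_of_frequently_eq_zero hconn ht₀
    (htendsto.frequently hev.frequently)

variable {n : ℕ}

/-- The inclusion `ℝⁿ ⊆ ℂⁿ`, as a real linear isometry. -/
def ofRealVecₗᵢ (n : ℕ) : EuclideanSpace ℝ (Fin n) →ₗᵢ[ℝ] EuclideanSpace ℂ (Fin n) where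
  toFun := ofRealVec
  map_add' x y := by ext; simp [ofRealVec]
  map_smul' c x := by ext; simp [ofRealVec]
  norm_map' := norm_ofRealVec

theorem ofRealVec_add (x y : EuclideanSpace ℝ (Fin n)) :
    ofRealVec (x + y) = ofRealVec x + ofRealVec y :=
  map_add (ofRealVecₗᵢ n) x y

theorem ofRealVec_smul (c : ℝ) (x : EuclideanSpace ℝ (Fin n)) :
    ofRealVec (c • x) = (c : ℂ) • ofRealVec x :=
  (map_smul (ofRealVecₗᵢ n) c x).trans (RCLike.real_smul_eq_coe_smul (K := ℂ) c _)

theorem ofRealVec_zero : ofRealVec (0 : EuclideanSpace ℝ (Fin n)) = 0 :=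
  map_zero (ofRealVecₗᵢ n)

/-- The real part of a vector of `ℂⁿ`, a left inverse of `ofRealVec`. -/
def reVec (n : ℕ) : EuclideanSpace ℂ (Fin n) →L[ℝ] EuclideanSpace ℝ (Fin n) :=
  (EuclideanSpace.equiv (Fin n) ℝ).symm.toContinuousLinearMap ∘L
    ContinuousLinearMap.pi fun j =>
      Complex.reCLM ∘L (EuclideanSpace.proj j : _ →L[ℂ] ℂ).restrictScalars ℝ

theorem reVec_apply (z : EuclideanSpace ℂ (Fin n)) (j : Fin n) : reVec n z j = (z j).re :=
  rfl

theorem reVec_ofRealVec (x : EuclideanSpace ℝ (Fin n)) : reVec n (ofRealVec x) = x :=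
  rfl

theorem norm_reVec_le (z : EuclideanSpace ℂ (Fin n)) : ‖reVec n z‖ ≤ ‖z‖ := by
  simp only [EuclideanSpace.norm_eq]
  gcongr with j
  exact Complex.abs_re_le_norm _

theorem exists_eq_ofRealVec_add_I_smul (z : EuclideanSpace ℂ (Fin n)) :
    ∃ y, z = ofRealVec (reVec n z) + Complex.I • ofRealVec y := by
  refine ⟨WithLp.toLp 2 fun j => (z j).im, ?_⟩
  ext j
  simp [ofRealVec, reVec_apply, mul_comm Complex.I, Complex.re_add_im]

theorem eventuallyEq_zero_of_eq_zero_ofRealVec {F : EuclideanSpace ℂ (Fin n) → G}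
    (hF : ∀ᶠ z in nhds 0, DifferentiableAt ℂ F z)
    (hzero : ∀ᶠ x in nhds 0, F (ofRealVec x) = 0) : F =ᶠ[nhds 0] 0 := by
  obtain ⟨r, hr, hdiff⟩ := Metric.eventually_nhds_iff_ball.1 hF
  obtain ⟨s, hs, hzero⟩ := Metric.eventually_nhds_iff_ball.1 hzero
  refine Metric.eventually_nhds_iff_ball.2 ⟨min r s, lt_min hr hs, fun z hz => ?_⟩
  obtain ⟨y, hy⟩ := exists_eq_ofRealVec_add_I_smul z
  set x := reVec n z
  rw [mem_ball_zero_iff] at hz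
  let slice : ℂ → EuclideanSpace ℂ (Fin n) := fun c => ofRealVec x + c • ofRealVec y
  have hslice : Differentiable ℂ slice := by fun_prop
  let U : Set ℂ := slice ⁻¹' Metric.ball 0 (min r s)
  have hU : IsOpen U := Metric.isOpen_ball.preimage hslice.continuous
  have hconvex : Convex ℝ U := by
    have hball : U = (LinearMap.toSpanSingleton ℂ _ (ofRealVec y)).restrictScalars ℝ ⁻¹'
        Metric.ball (-ofRealVec x) (min r s) := by
      ext c
      simp [U, slice, dist_eq_norm, add_comm]
    exact hball ▸ (convex_ball _ _).linear_preimage _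
  have hdiffOn : DifferentiableOn ℂ (F ∘ slice) U := fun c hc =>
    ((hdiff _ (Metric.ball_subset_ball (min_le_left r s) hc)).comp c
      (hslice c)).differentiableWithinAt
  have hslice_zero (t : ℝ) (ht : (t : ℂ) ∈ U) : (F ∘ slice) t = 0 := by
    have hreal : slice t = ofRealVec (x + t • y) := by
      rw [ofRealVec_add, ofRealVec_smul]
    have hnorm : ‖slice t‖ < min r s := mem_ball_zero_iff.1 ht
    rw [hreal, norm_ofRealVec] at hnorm
    rw [Function.comp_apply, hreal]
    exact hzero _ (mem_ball_zero_iff.2 (hnorm.trans_le (min_le_right r s)))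
  have hzero_mem : ((0 : ℝ) : ℂ) ∈ U := by
    simpa [U, slice, norm_ofRealVec] using lt_min_iff.1 ((norm_reVec_le z).trans_lt hz)
  have hI_mem : Complex.I ∈ U := by
    have hz_eq : slice Complex.I = z := hy.symm
    rwa [Set.mem_preimage, hz_eq, mem_ball_zero_iff]
  rw [hy]
  exact eqOn_zero_of_eq_zero_ofReal hU hconvex.isPreconnected hdiffOn hzero_mem hslice_zero hI_mem

theorem isOpen_lieBall (n : ℕ) : IsOpen (lieBall n) := by
  have hquad := (differentiable_quad (n := n)).continuous
  have hcont : Continuous fun z : EuclideanSpace ℂ (Fin n) =>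
      1 - 2 * ‖z‖ ^ 2 + ‖quad z‖ ^ 2 := by
    fun_prop
  exact (isOpen_lt continuous_const hcont).inter (isOpen_lt continuous_norm continuous_const)

theorem lieBall_mem_nhds_zero (n : ℕ) : lieBall n ∈ nhds 0 :=
  (isOpen_lieBall n).mem_nhds zero_mem_lieBall

theorem quad_smul (c : ℂ) (z : EuclideanSpace ℂ (Fin n)) : quad (c • z) = c ^ 2 * quad z := by
  simp only [quad, PiLp.smul_apply, smul_eq_mul, mul_pow, Finset.mul_sum]

theorem smul_mem_lieBall {c : ℂ} (hc : ‖c‖ ≤ 1) {z : EuclideanSpace ℂ (Fin n)}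
    (hz : z ∈ lieBall n) : c • z ∈ lieBall n := by
  have hc_sq : ‖c‖ ^ 2 ≤ 1 := pow_le_one₀ (norm_nonneg c) hc
  have hquad_sq : ‖quad z‖ ^ 2 ≤ ‖z‖ ^ 2 :=
    (pow_le_of_le_one (norm_nonneg _) (norm_quad_lt_one hz).le two_ne_zero).trans (norm_quad_le z)
  refine ⟨?_, ?_⟩
  · have hdiff : 0 ≤ (1 - ‖c‖ ^ 2) * (2 * ‖z‖ ^ 2 - (1 + ‖c‖ ^ 2) * ‖quad z‖ ^ 2) := by
      refine mul_nonneg (sub_nonneg.2 hc_sq) (sub_nonneg.2 ?_)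
      exact mul_le_mul (by linarith) hquad_sq (sq_nonneg _) zero_le_two
    rw [norm_smul, quad_smul, norm_mul, norm_pow]
    linarith [hz.1]
  · rw [norm_smul]
    exact (mul_le_of_le_one_left (norm_nonneg z) hc).trans_lt hz.2

theorem starConvex_lieBall (n : ℕ) : StarConvex ℝ 0 (lieBall n) :=
  starConvex_zero_iff.2 fun z hz t ht ht1 => by
    rw [RCLike.real_smul_eq_coe_smul (K := ℂ)]
    exact smul_mem_lieBall (by simpa [abs_of_nonneg ht] using ht1) hz

theorem eqOn_lieBall_of_eq_ofRealVec {F₁ F₂ : EuclideanSpace ℂ (Fin n) → G}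
    (h₁ : DifferentiableOn ℂ F₁ (lieBall n)) (h₂ : DifferentiableOn ℂ F₂ (lieBall n))
    (heq : ∀ x, ‖x‖ < 1 → F₁ (ofRealVec x) = F₂ (ofRealVec x)) : Set.EqOn F₁ F₂ (lieBall n) := by
  have hsub := h₁.sub h₂
  have hzero : F₁ - F₂ =ᶠ[nhds 0] 0 := by
    refine eventuallyEq_zero_of_eq_zero_ofRealVec ?_ ?_
    · filter_upwards [lieBall_mem_nhds_zero n] with z hz
      exact hsub.differentiableAt ((isOpen_lieBall n).mem_nhds hz)
    · filter_upwards [Metric.ball_mem_nhds 0 one_pos] with x hx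
      exact sub_eq_zero.2 (heq x (mem_ball_zero_iff.1 hx))
  exact fun z hz => sub_eq_zero.1
    (eqOn_zero_of_starConvex (isOpen_lieBall n) (starConvex_lieBall n) hsub hzero hz)

end IdentityTheorem

/-! ### Automorphisms that fix the origin and preserve the real part -/

section FixedOrigin

theorem eqOn_smul_deriv_of_norm_eq {G : Type*} [NormedAddCommGroup G] [NormedSpace ℂ G]
    [StrictConvexSpace ℝ G] {f : ℂ → G} (hf : DifferentiableOn ℂ f (Metric.ball 0 1))
    (hmaps : Set.MapsTo f (Metric.ball 0 1) (Metric.closedBall 0 1)) (hzero : f 0 = 0) {c : ℂ}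
    (hc : c ∈ Metric.ball (0 : ℂ) 1) (hc0 : c ≠ 0) (hnorm : ‖f c‖ = ‖c‖) :
    Set.EqOn f (fun z => z • deriv f 0) (Metric.ball 0 1) := by
  have hdslope : ‖dslope f 0 c‖ = 1 / 1 := by
    rw [dslope_of_ne _ hc0, slope_def_module, hzero, sub_zero, sub_zero, norm_smul, norm_inv, hnorm,
      inv_mul_cancel₀ (norm_ne_zero_iff.2 hc0), div_one]
  have haffine : Set.EqOn f (fun z => z • dslope f 0 c) (Metric.ball 0 1) := fun z hz => by
    simpa [hzero] using Complex.affine_of_mapsTo_ball_of_norm_dslope_eq_div hf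
      (by rwa [hzero]) hc hdslope hz
  have hderiv : deriv f 0 = dslope f 0 c := by
    have hid := (hasDerivAt_id (0 : ℂ)).smul_const (dslope f 0 c)
    rw [one_smul] at hid
    exact (hid.congr_of_eventuallyEq
      (haffine.eventuallyEq_of_mem (Metric.ball_mem_nhds 0 one_pos))).deriv
  rwa [hderiv]

variable {n : ℕ} {G : Type*} [NormedAddCommGroup G] [NormedSpace ℂ G]
  {F : EuclideanSpace ℂ (Fin n) → G}

theorem div_norm_smul_ofRealVec_mem_lieBall {c : ℂ} (hc : c ∈ Metric.ball 0 1)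
    (x : EuclideanSpace ℝ (Fin n)) : (c / ‖x‖) • ofRealVec x ∈ lieBall n := by
  have hnorm : ‖(c / ‖x‖) • ofRealVec x‖ = ‖c / ‖x‖‖ * ‖x‖ := by
    rw [norm_smul, norm_ofRealVec]
  refine mem_lieBall_of_norm_quad_eq ?_ (hnorm.trans_lt ?_)
  · rw [hnorm, quad_smul, quad_ofRealVec, norm_mul, norm_pow, Complex.norm_real,
      Real.norm_of_nonneg (sq_nonneg _), mul_pow]
  · rw [norm_div, Complex.norm_real, norm_norm, div_mul_eq_mul_div, mul_div_assoc]
    exact (mul_le_of_le_one_right (norm_nonneg c) (div_self_le_one _)).trans_lt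
      (mem_ball_zero_iff.1 hc)

theorem norm_apply_ofRealVec_le (hF : DifferentiableOn ℂ F (lieBall n))
    (hmaps : Set.MapsTo F (lieBall n) (Metric.closedBall 0 1)) (hzero : F 0 = 0)
    {x : EuclideanSpace ℝ (Fin n)} (hx : ‖x‖ < 1) : ‖F (ofRealVec x)‖ ≤ ‖x‖ := by
  have hschwarz := Complex.norm_le_norm_of_mapsTo_ball
    (f := fun c : ℂ => F ((c / ‖x‖) • ofRealVec x)) (z := ‖x‖)
    (hF.comp (by fun_prop) fun c hc => div_norm_smul_ofRealVec_mem_lieBall hc x)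
    (fun c hc => hmaps (div_norm_smul_ofRealVec_mem_lieBall hc x)) (by simpa using hzero)
    (by simpa using hx)
  have hone : (‖x‖ / ‖x‖ : ℂ) • ofRealVec x = ofRealVec x := by
    rcases eq_or_ne x 0 with rfl | hx0
    · rw [ofRealVec_zero, smul_zero]
    · rw [div_self (Complex.ofReal_ne_zero.2 (norm_ne_zero_iff.2 hx0)), one_smul]
  simpa [hone] using hschwarz

theorem apply_ofRealVec_eq_fderiv [StrictConvexSpace ℝ G] (hF : DifferentiableOn ℂ F (lieBall n))
    (hmaps : Set.MapsTo F (lieBall n) (Metric.closedBall 0 1)) (hzero : F 0 = 0)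
    {x : EuclideanSpace ℝ (Fin n)} (hx : ‖x‖ < 1) (hnorm : ‖F (ofRealVec x)‖ = ‖x‖) :
    F (ofRealVec x) = fderiv ℂ F 0 (ofRealVec x) := by
  have hdiff := hF.differentiableAt (lieBall_mem_nhds_zero n)
  rcases eq_or_ne x 0 with rfl | hx0
  · rw [ofRealVec_zero, hzero, map_zero]
  have hx_norm : (‖x‖ : ℂ) ≠ 0 := Complex.ofReal_ne_zero.2 (norm_ne_zero_iff.2 hx0)
  have hderiv : HasDerivAt (fun c : ℂ => F ((c / ‖x‖) • ofRealVec x))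
      (fderiv ℂ F 0 ((1 / ‖x‖ : ℂ) • ofRealVec x)) 0 := by
    have hline := ((hasDerivAt_id (0 : ℂ)).div_const (‖x‖ : ℂ)).smul_const (ofRealVec x)
    exact HasFDerivAt.comp_hasDerivAt 0 (by simpa using hdiff.hasFDerivAt) hline
  have hslice := eqOn_smul_deriv_of_norm_eq (f := fun c : ℂ => F ((c / ‖x‖) • ofRealVec x))
    (c := ‖x‖)
    (hF.comp (by fun_prop) fun c hc => div_norm_smul_ofRealVec_mem_lieBall hc x)
    (fun c hc => hmaps (div_norm_smul_ofRealVec_mem_lieBall hc x)) (by simpa using hzero)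
    (by simpa using hx) hx_norm (by simpa [div_self hx_norm] using hnorm)
    (show (‖x‖ : ℂ) ∈ Metric.ball 0 1 by simpa using hx)
  simpa [hderiv.deriv, div_self hx_norm, smul_smul, mul_inv_cancel₀ hx_norm] using hslice

/-- An automorphism of the Lie ball that maps real points to real points, as do the elements of
`groupH`. -/
def PreservesRealPart (h : aut n) : Prop :=
  ∀ x : lieBall n, (x : EuclideanSpace ℂ (Fin n)) ∈ realPart n →
    (h.1 x : EuclideanSpace ℂ (Fin n)) ∈ realPart n

theorem ofRealVec_mem_realPart {x : EuclideanSpace ℝ (Fin n)} (hx : ‖x‖ < 1) :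
    ofRealVec x ∈ realPart n :=
  ⟨ofRealVec_mem_lieBall_iff.2 hx, x, rfl⟩

theorem norm_apply_ofRealVec_eq {F' : EuclideanSpace ℂ (Fin n) → EuclideanSpace ℂ (Fin n)}
    {F : EuclideanSpace ℂ (Fin n) → EuclideanSpace ℂ (Fin n)}
    (hF : DifferentiableOn ℂ F (lieBall n)) (hmaps : Set.MapsTo F (lieBall n) (lieBall n))
    (hF' : DifferentiableOn ℂ F' (lieBall n)) (hmaps' : Set.MapsTo F' (lieBall n) (lieBall n))
    (hinv : Set.LeftInvOn F' F (lieBall n)) (hzero : F 0 = 0)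
    {x : EuclideanSpace ℝ (Fin n)} (hx : ‖x‖ < 1) (hreal : F (ofRealVec x) ∈ Set.range ofRealVec) :
    ‖F (ofRealVec x)‖ = ‖x‖ := by
  have hball : lieBall n ⊆ Metric.closedBall 0 1 := fun z hz =>
    mem_closedBall_zero_iff.2 hz.2.le
  have hx_mem := ofRealVec_mem_lieBall_iff.2 hx
  refine le_antisymm (norm_apply_ofRealVec_le hF (hmaps.mono_right hball) hzero hx) ?_
  obtain ⟨y, hy⟩ := hreal
  have hzero' : F' 0 = 0 := by
    simpa only [hzero] using hinv zero_mem_lieBall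
  have hy_mem : ‖y‖ < 1 := ofRealVec_mem_lieBall_iff.1 (hy ▸ hmaps hx_mem)
  have hle := norm_apply_ofRealVec_le hF' (hmaps'.mono_right hball) hzero' hy_mem
  rwa [hy, hinv hx_mem, norm_ofRealVec, ← norm_ofRealVec y, hy] at hle

theorem norm_map_of_norm_lt_one {E₁ E₂ : Type*} [NormedAddCommGroup E₁] [NormedSpace ℝ E₁]
    [NormedAddCommGroup E₂] [NormedSpace ℝ E₂] {T : E₁ →ₗ[ℝ] E₂}
    (hT : ∀ x, ‖x‖ < 1 → ‖T x‖ = ‖x‖) (x : E₁) : ‖T x‖ = ‖x‖ := by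
  have hpos : 0 < (‖x‖ + 1)⁻¹ := by positivity
  have hlt : ‖(‖x‖ + 1)⁻¹ • x‖ < 1 := by
    rw [norm_smul, Real.norm_of_nonneg hpos.le, inv_mul_lt_one₀ (by positivity)]
    exact lt_add_one _
  have hscaled := hT _ hlt
  rwa [map_smul, norm_smul, norm_smul, mul_right_inj' (norm_ne_zero_iff.2 hpos.ne')] at hscaled

theorem PreservesRealPart.exists_linearIsometry {h : aut n} (hreal : PreservesRealPart h)
    (hzero : (h.1 ⟨0, zero_mem_lieBall⟩ : EuclideanSpace ℂ (Fin n)) = 0) :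
    ∃ T : EuclideanSpace ℝ (Fin n) →ₗᵢ[ℝ] EuclideanSpace ℝ (Fin n), ∀ x (hx : ‖x‖ < 1),
      (h.1 ⟨ofRealVec x, ofRealVec_mem_lieBall_iff.2 hx⟩ : EuclideanSpace ℂ (Fin n)) =
        ofRealVec (T x) := by
  let _ : InnerProductSpace ℝ (EuclideanSpace ℂ (Fin n)) := InnerProductSpace.rclikeToReal ℂ _
  obtain ⟨⟨F, hF, hFh⟩, ⟨F', hF', hFh'⟩⟩ := h.2
  have hmaps : Set.MapsTo F (lieBall n) (lieBall n) := fun z hz => hFh ⟨z, hz⟩ ▸ Subtype.coe_prop _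
  have hmaps' : Set.MapsTo F' (lieBall n) (lieBall n) := fun z hz =>
    hFh' ⟨z, hz⟩ ▸ Subtype.coe_prop _
  have hinv : Set.LeftInvOn F' F (lieBall n) := fun z hz => by
    rw [hFh ⟨z, hz⟩, hFh', Homeomorph.symm_apply_apply]
  have hzeroF : F 0 = 0 := (hFh ⟨0, zero_mem_lieBall⟩).trans hzero
  have hrealF {x} (hx : ‖x‖ < 1) : F (ofRealVec x) ∈ Set.range ofRealVec := by
    rw [hFh ⟨_, ofRealVec_mem_lieBall_iff.2 hx⟩]
    exact (hreal ⟨_, _⟩ (ofRealVec_mem_realPart hx)).2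
  have hnorm {x} (hx : ‖x‖ < 1) : ‖F (ofRealVec x)‖ = ‖x‖ :=
    norm_apply_ofRealVec_eq hF hmaps hF' hmaps' hinv hzeroF hx (hrealF hx)
  let T : EuclideanSpace ℝ (Fin n) →ₗ[ℝ] EuclideanSpace ℝ (Fin n) :=
    (reVec n).toLinearMap ∘ₗ ((fderiv ℂ F 0).toLinearMap.restrictScalars ℝ) ∘ₗ
      (ofRealVecₗᵢ n).toLinearMap
  have hT {x} (hx : ‖x‖ < 1) : F (ofRealVec x) = ofRealVec (T x) := by
    have hlin : T x = reVec n (F (ofRealVec x)) := congrArg (reVec n)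
      (apply_ofRealVec_eq_fderiv hF (fun z hz => mem_closedBall_zero_iff.2 (hmaps hz).2.le) hzeroF
        hx (hnorm hx)).symm
    obtain ⟨y, hy⟩ := hrealF hx
    rw [hlin, ← hy, reVec_ofRealVec]
  refine ⟨⟨T, norm_map_of_norm_lt_one fun x hx => ?_⟩, fun x hx => ?_⟩
  · rw [← norm_ofRealVec, ← hT hx, hnorm hx]
  · exact (hFh ⟨_, _⟩).symm.trans (hT hx)

end FixedOrigin

/-! ### The subgroup preserving the real part -/

section RealPart

variable {n : ℕ}

section InsertSecond

variable {R : Type*}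

/-- The vector obtained from one of length `1 + n` by inserting `t` as the second coordinate; the
embedding `thetaMat` is the one that fixes the inserted coordinate. -/
def insertSecond (u : Fin 1 ⊕ Fin n → R) (t : R) : Fin 2 ⊕ Fin n → R :=
  Sum.elim ![u (Sum.inl 0), t] (fun j => u (Sum.inr j))

theorem thetaMat_map_mulVec_insertSecond [CommRing R] (f : ℝ →+* R)
    (g : Matrix (Fin 1 ⊕ Fin n) (Fin 1 ⊕ Fin n) ℝ) (u : Fin 1 ⊕ Fin n → R) (t : R) :
    (thetaMat g).map f *ᵥ insertSecond u t = insertSecond (g.map f *ᵥ u) t := by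
  ext (k | k)
  · fin_cases k <;> simp [insertSecond, thetaMat, Matrix.mulVec, dotProduct]
  · simp [insertSecond, thetaMat, Matrix.mulVec, dotProduct, Matrix.toBlocks₂₂]

end InsertSecond

theorem form_insertSecond (u v : Fin 1 ⊕ Fin n → ℝ) (s t : ℝ) :
    form 2 n (insertSecond u s) (insertSecond v t) = form 1 n u v + s * t := by
  simp only [form, insertSecond, Sum.elim_inl, Sum.elim_inr, Fin.sum_univ_two,
    Finset.univ_unique, Finset.sum_singleton, Fin.default_eq_zero, Matrix.cons_val_zero,
    Matrix.cons_val_one]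
  ring

theorem preservesForm_thetaMat_iff {g : Matrix (Fin 1 ⊕ Fin n) (Fin 1 ⊕ Fin n) ℝ} :
    PreservesForm (thetaMat g) ↔ PreservesForm g := by
  refine ⟨fun hg u v => ?_, thetaMat_form g⟩
  have hmulVec (u : Fin 1 ⊕ Fin n → ℝ) :
      thetaMat g *ᵥ insertSecond u 0 = insertSecond (g *ᵥ u) 0 :=
    thetaMat_map_mulVec_insertSecond (RingHom.id ℝ) g u 0
  simpa only [hmulVec, form_insertSecond, mul_zero, add_zero] using
    hg (insertSecond u 0) (insertSecond v 0)

theorem isOrthochronous_thetaMat_iff {g : Matrix (Fin 1 ⊕ Fin n) (Fin 1 ⊕ Fin n) ℝ} :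
    IsOrthochronous (thetaMat g) ↔ PreservesForm g ∧ 0 < g (Sum.inl 0) (Sum.inl 0) := by
  rw [IsOrthochronous.iff_det_pos, preservesForm_thetaMat_iff, thetaMat,
    Matrix.toBlocks_fromBlocks₁₁, Matrix.det_fin_two_of, mul_one, mul_zero, sub_zero]

/-- The timelike vector `((1 + |x|²) / 2, x)`, which is `isotropicLift (ofRealVec x)` with its
imaginary second coordinate deleted. -/
def timelikeLift (x : EuclideanSpace ℝ (Fin n)) : Fin 1 ⊕ Fin n → ℝ :=
  Sum.elim (fun _ => (1 + ‖x‖ ^ 2) / 2) x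

theorem isotropicLift_ofRealVec (x : EuclideanSpace ℝ (Fin n)) :
    isotropicLift (ofRealVec x) = insertSecond (fun k => (timelikeLift x k : ℂ))
      (-Complex.I * ((1 - ‖x‖ ^ 2) / 2 : ℝ)) := by
  ext (k | k)
  · fin_cases k
    · simp [isotropicLift, insertSecond, timelikeLift, planeVec, quad_ofRealVec]
    · simp [isotropicLift, insertSecond, planeVec, quad_ofRealVec]
      ring
  · rfl

theorem mulVec_isotropicLift_ofRealVec (g : Matrix (Fin 1 ⊕ Fin n) (Fin 1 ⊕ Fin n) ℝ)
    (x : EuclideanSpace ℝ (Fin n)) :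
    (thetaMat g).map Complex.ofRealHom *ᵥ isotropicLift (ofRealVec x) =
      insertSecond (fun k => ((g *ᵥ timelikeLift x) k : ℂ))
        (-Complex.I * ((1 - ‖x‖ ^ 2) / 2 : ℝ)) := by
  rw [isotropicLift_ofRealVec, thetaMat_map_mulVec_insertSecond]
  congr 1
  exact funext fun k => (Complex.ofRealHom.map_mulVec g (timelikeLift x) k).symm

theorem act_thetaMat_ofRealVec (g : Matrix (Fin 1 ⊕ Fin n) (Fin 1 ⊕ Fin n) ℝ)
    (x : EuclideanSpace ℝ (Fin n)) :
    act (thetaMat g) (ofRealVec x) =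
      ofRealVec (((g *ᵥ timelikeLift x) (Sum.inl 0) + (1 - ‖x‖ ^ 2) / 2)⁻¹ •
        WithLp.toLp 2 fun j => (g *ᵥ timelikeLift x) (Sum.inr j)) := by
  have hfactor (a t : ℝ) : (a : ℂ) + Complex.I * (-Complex.I * t) = (a + t : ℝ) := by
    push_cast
    linear_combination -(t : ℂ) * Complex.I_sq
  ext j
  rw [act, mulVec_isotropicLift_ofRealVec]
  simp only [ofIsotropic, homFactor, insertSecond, Sum.elim_inl, Sum.elim_inr,
    Matrix.cons_val_zero, Matrix.cons_val_one, hfactor, ofRealVec, PiLp.smul_apply, smul_eq_mul]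
  rw [Complex.ofReal_mul, Complex.ofReal_inv]

namespace PreservesLieCone

variable {g : Matrix (Fin 1 ⊕ Fin n) (Fin 1 ⊕ Fin n) ℝ}

theorem act_thetaMat_mem_realPart (hg : PreservesLieCone (thetaMat g))
    {z : EuclideanSpace ℂ (Fin n)} (hz : z ∈ realPart n) : act (thetaMat g) z ∈ realPart n := by
  obtain ⟨hz_mem, x, rfl⟩ := hz
  exact ⟨hg.act_mem_lieBall hz_mem, _, (act_thetaMat_ofRealVec g x).symm⟩

theorem mulVec_timelikeLift (hg : PreservesLieCone (thetaMat g)) {x y : EuclideanSpace ℝ (Fin n)}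
    (hx : ‖x‖ < 1) (hxy : act (thetaMat g) (ofRealVec x) = ofRealVec y) :
    g *ᵥ timelikeLift x = ((1 - ‖x‖ ^ 2) / (1 - ‖y‖ ^ 2)) • timelikeLift y := by
  have hx_mem := ofRealVec_mem_lieBall_iff.2 hx
  have hy : ‖y‖ < 1 := ofRealVec_mem_lieBall_iff.1 (hxy ▸ hg.act_mem_lieBall hx_mem)
  have hy_ne : (1 - ‖y‖ ^ 2 : ℂ) ≠ 0 := by
    exact_mod_cast (sub_pos.2 ((sq_lt_one_iff₀ (norm_nonneg y)).2 hy)).ne'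
  have hlift := hg.homFactor_smul_isotropicLift_act hx_mem
  rw [hxy, mulVec_isotropicLift_ofRealVec, isotropicLift_ofRealVec] at hlift
  set c := homFactor (insertSecond (fun k => ((g *ᵥ timelikeLift x) k : ℂ))
    (-Complex.I * ((1 - ‖x‖ ^ 2) / 2 : ℝ)))
  -- the second coordinate, fixed by `thetaMat g`, determines the proportionality factor
  have hc : c = ((1 - ‖x‖ ^ 2) / (1 - ‖y‖ ^ 2) : ℝ) := by
    have hsecond : c * (-Complex.I * ((1 - ‖y‖ ^ 2) / 2 : ℝ)) =
        -Complex.I * ((1 - ‖x‖ ^ 2) / 2 : ℝ) := congrFun hlift (Sum.inl 1)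
    push_cast at hsecond ⊢
    rw [eq_div_iff hy_ne]
    linear_combination 2 * Complex.I * hsecond +
      (c * (1 - ‖y‖ ^ 2) - (1 - ‖x‖ ^ 2)) * Complex.I_sq
  rw [hc] at hlift
  ext (k | k)
  · rw [Subsingleton.elim k 0]
    exact Complex.ofReal_injective ((congrFun hlift (Sum.inl 0)).symm.trans
      (Complex.ofReal_mul _ _).symm)
  · exact Complex.ofReal_injective ((congrFun hlift (Sum.inr k)).symm.trans
      (Complex.ofReal_mul _ _).symm)

end PreservesLieCone

theorem IsOrthochronous.preservesRealPart_toAut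
    {g : Matrix (Fin 1 ⊕ Fin n) (Fin 1 ⊕ Fin n) ℝ} (hg : IsOrthochronous (thetaMat g)) :
    PreservesRealPart hg.toAut :=
  fun _ hz => hg.2.act_thetaMat_mem_realPart hz

theorem IsOrthochronous.preservesRealPart_toAut_inv
    {g : Matrix (Fin 1 ⊕ Fin n) (Fin 1 ⊕ Fin n) ℝ} (hg : IsOrthochronous (thetaMat g)) :
    PreservesRealPart hg.toAut⁻¹ := by
  have hinv : (thetaMat g)⁻¹ = thetaMat g⁻¹ := by
    refine Matrix.inv_eq_right_inv ?_
    rw [← thetaMat_mul, Matrix.mul_nonsing_inv g (preservesForm_thetaMat_iff.1 hg.1).isUnit_det,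
      thetaMat_one]
  have hg_inv : IsOrthochronous (thetaMat g⁻¹) := hinv ▸ hg.inv
  rw [← hg.toAut_inv]
  simpa only [hinv] using hg_inv.preservesRealPart_toAut

section HalfTurn

variable {p q : ℕ}

open LieAlgebra.Orthogonal (indefiniteDiagonal)

/-- The half turn that fixes `m` and is `-1` on its orthogonal complement for the form of signature
`(p,q)`; junk when `m` is isotropic. -/
def halfTurn (m : Fin p ⊕ Fin q → ℝ) : Matrix (Fin p ⊕ Fin q) (Fin p ⊕ Fin q) ℝ :=
  (2 / form p q m m) • Matrix.vecMulVec m (indefiniteDiagonal (Fin p) (Fin q) ℝ *ᵥ m) - 1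

theorem halfTurn_mulVec (m v : Fin p ⊕ Fin q → ℝ) :
    halfTurn m *ᵥ v = (2 * form p q v m / form p q m m) • m - v := by
  have hform : form p q v m = v ⬝ᵥ indefiniteDiagonal (Fin p) (Fin q) ℝ *ᵥ m :=
    formOver_eq_dotProduct_mulVec v m
  ext k
  rw [halfTurn, Matrix.sub_mulVec, Matrix.one_mulVec, Matrix.smul_mulVec, Matrix.vecMulVec_mulVec,
    dotProduct_comm, ← hform]
  simp only [Pi.sub_apply, Pi.smul_apply, MulOpposite.smul_eq_mul_unop, MulOpposite.unop_op,
    smul_eq_mul]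
  ring

theorem preservesForm_halfTurn {m : Fin p ⊕ Fin q → ℝ} (hm : form p q m m ≠ 0) :
    PreservesForm (halfTurn m) := by
  have hcomm (v w : Fin p ⊕ Fin q → ℝ) : form p q v w = form p q w v := by
    simp only [form, mul_comm]
  have hexpand (a b : ℝ) (v w : Fin p ⊕ Fin q → ℝ) : form p q (a • m - v) (b • m - w) =
      a * b * form p q m m - a * form p q w m - b * form p q v m + form p q v w := by
    rw [hcomm w m]
    change formOver ℝ _ _ = _ * formOver ℝ _ _ - _ * formOver ℝ _ _ - _ * formOver ℝ _ _ +
      formOver ℝ _ _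
    simp only [formOver_eq_dotProduct_mulVec, Matrix.mulVec_sub, Matrix.mulVec_smul,
      dotProduct_sub, sub_dotProduct, dotProduct_smul, smul_dotProduct, smul_eq_mul]
    ring
  intro v w
  rw [halfTurn_mulVec, halfTurn_mulVec, hexpand]
  field_simp
  ring

end HalfTurn

section HalfTurnAction

variable {x : EuclideanSpace ℝ (Fin n)}

theorem form_elim_one_self (x : EuclideanSpace ℝ (Fin n)) :
    form 1 n (Sum.elim (fun _ => 1) x) (Sum.elim (fun _ => 1) x) = 1 - ‖x‖ ^ 2 := by
  simp [form, EuclideanSpace.real_norm_sq_eq, ← sq]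

theorem isOrthochronous_thetaMat_halfTurn (hx : ‖x‖ < 1) :
    IsOrthochronous (thetaMat (halfTurn (Sum.elim (fun _ : Fin 1 => 1) x))) := by
  have hpos : 0 < 1 - ‖x‖ ^ 2 := sub_pos.2 ((sq_lt_one_iff₀ (norm_nonneg x)).2 hx)
  refine isOrthochronous_thetaMat_iff.2 ⟨preservesForm_halfTurn ?_, ?_⟩
  · rw [form_elim_one_self]
    exact hpos.ne'
  · have hentry : halfTurn (Sum.elim (fun _ : Fin 1 => 1) x) (Sum.inl 0) (Sum.inl 0) =
        (1 + ‖x‖ ^ 2) / (1 - ‖x‖ ^ 2) := by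
      rw [halfTurn, form_elim_one_self]
      simp [Matrix.vecMulVec_apply, LieAlgebra.Orthogonal.indefiniteDiagonal,
        Matrix.mulVec_diagonal]
      field_simp
      ring
    rw [hentry]
    positivity

theorem act_thetaMat_halfTurn_zero (hx : ‖x‖ < 1) :
    act (thetaMat (halfTurn (Sum.elim (fun _ : Fin 1 => 1) x))) 0 = ofRealVec x := by
  have hne : 1 - ‖x‖ ^ 2 ≠ 0 := (sub_pos.2 ((sq_lt_one_iff₀ (norm_nonneg x)).2 hx)).ne'
  have hform : form 1 n (timelikeLift 0) (Sum.elim (fun _ => 1) x) = 1 / 2 := by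
    simp [form, timelikeLift]
  have hmulVec : halfTurn (Sum.elim (fun _ : Fin 1 => 1) x) *ᵥ timelikeLift 0 =
      (1 - ‖x‖ ^ 2)⁻¹ • Sum.elim (fun _ : Fin 1 => 1) x - timelikeLift 0 := by
    rw [halfTurn_mulVec, hform, form_elim_one_self, mul_one_div_cancel two_ne_zero, one_div]
  rw [← ofRealVec_zero, act_thetaMat_ofRealVec, hmulVec]
  congr 1
  ext j
  simp [timelikeLift, hne]

end HalfTurnAction

section Rotation

variable (T : EuclideanSpace ℝ (Fin n) →ₗᵢ[ℝ] EuclideanSpace ℝ (Fin n))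

/-- The matrix `(1 0; 0 T)`, by which a linear isometry of `ℝⁿ` acts on the timelike lifts. -/
def rotation : Matrix (Fin 1 ⊕ Fin n) (Fin 1 ⊕ Fin n) ℝ :=
  Matrix.fromBlocks 1 0 0 (Matrix.toEuclideanLin.symm T.toLinearMap)

theorem rotation_mulVec (u : Fin 1 ⊕ Fin n → ℝ) :
    rotation T *ᵥ u =
      Sum.elim (fun i => u (Sum.inl i)) (T (WithLp.toLp 2 fun j => u (Sum.inr j))) := by
  have hT (v : Fin n → ℝ) :
      Matrix.toEuclideanLin.symm T.toLinearMap *ᵥ v = T (WithLp.toLp 2 v) := by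
    have happly := DFunLike.congr_fun
      (Matrix.toEuclideanLin.apply_symm_apply T.toLinearMap) (WithLp.toLp 2 v)
    rw [Matrix.toLpLin_toLp] at happly
    exact congrArg WithLp.ofLp happly
  rw [rotation, Matrix.fromBlocks_mulVec, Matrix.one_mulVec, Matrix.zero_mulVec,
    Matrix.zero_mulVec, add_zero, zero_add, hT]
  rfl

theorem isOrthochronous_thetaMat_rotation : IsOrthochronous (thetaMat (rotation T)) := by
  refine isOrthochronous_thetaMat_iff.2 ⟨fun u v => ?_, by simp [rotation]⟩
  have hinner := T.inner_map_map (WithLp.toLp 2 fun j => u (Sum.inr j))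
    (WithLp.toLp 2 fun j => v (Sum.inr j))
  simp only [PiLp.inner_apply, RCLike.inner_apply, conj_trivial] at hinner
  simp only [form, rotation_mulVec, Sum.elim_inl, Sum.elim_inr]
  congr 1
  simpa only [mul_comm] using hinner

theorem act_thetaMat_rotation_ofRealVec (x : EuclideanSpace ℝ (Fin n)) :
    act (thetaMat (rotation T)) (ofRealVec x) = ofRealVec (T x) := by
  have htimelike : rotation T *ᵥ timelikeLift x = timelikeLift (T x) := by
    rw [rotation_mulVec, timelikeLift, timelikeLift, T.norm_map]
    rfl
  rw [act, mulVec_isotropicLift_ofRealVec, htimelike, ← T.norm_map x, ← isotropicLift_ofRealVec,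
    ofIsotropic_isotropicLift]

end Rotation

namespace PreservesRealPart

variable {h k : aut n}

protected theorem mul (hh : PreservesRealPart h) (hk : PreservesRealPart k) :
    PreservesRealPart (h * k) :=
  fun z hz => hh (k.1 z) (hk z hz)

theorem exists_eq_toAut_of_apply_zero (hreal : PreservesRealPart h)
    (hzero : (h.1 ⟨0, zero_mem_lieBall⟩ : EuclideanSpace ℂ (Fin n)) = 0) :
    ∃ (g : Matrix (Fin 1 ⊕ Fin n) (Fin 1 ⊕ Fin n) ℝ) (hg : IsOrthochronous (thetaMat g)),
      h = hg.toAut := by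
  obtain ⟨T, hT⟩ := hreal.exists_linearIsometry hzero
  obtain ⟨F, hF, hF_eq⟩ := h.2.1
  have hg := isOrthochronous_thetaMat_rotation T
  have heqOn : Set.EqOn F (act (thetaMat (rotation T))) (lieBall n) :=
    eqOn_lieBall_of_eq_ofRealVec hF hg.2.differentiableOn_act fun x hx => by
      rw [act_thetaMat_rotation_ofRealVec, ← hT x hx, ← hF_eq]
  exact ⟨_, hg, Subtype.ext <| Homeomorph.ext fun z => Subtype.ext <|
    (hF_eq z).symm.trans (heqOn z.2)⟩

theorem exists_eq_toAut (hreal : PreservesRealPart h) :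
    ∃ (g : Matrix (Fin 1 ⊕ Fin n) (Fin 1 ⊕ Fin n) ℝ) (hg : IsOrthochronous (thetaMat g)),
      h = hg.toAut := by
  obtain ⟨hball, x, hx⟩ := hreal ⟨0, zero_mem_lieBall⟩ ⟨zero_mem_lieBall, 0, ofRealVec_zero⟩
  rw [← hx, ofRealVec_mem_lieBall_iff] at hball
  have hR := isOrthochronous_thetaMat_halfTurn hball
  have hzero : hR.toAut⁻¹.1 (h.1 ⟨0, zero_mem_lieBall⟩) = ⟨0, zero_mem_lieBall⟩ :=
    (Homeomorph.symm_apply_eq _).2 <| Subtype.ext <|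
      hx.symm.trans (act_thetaMat_halfTurn_zero hball).symm
  obtain ⟨g, hg, hk⟩ := (hR.preservesRealPart_toAut_inv.mul hreal).exists_eq_toAut_of_apply_zero
    (congrArg Subtype.val hzero)
  refine ⟨_ * g, thetaMat_mul _ g ▸ hR.mul hg, ?_⟩
  calc h = hR.toAut * hg.toAut := by rw [← hk, mul_inv_cancel_left]
    _ = (hR.mul hg).toAut := (hR.toAut_mul hg).symm
    _ = _ := by simp only [thetaMat_mul]

end PreservesRealPart

end RealPart

/-! ### The group `H` -/

section GroupH

variable {n : ℕ}

theorem subset_range_of_isPreconnected {p q : ℕ} {B : Type*} [Group B] [TopologicalSpace B]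
    {Ψ : SOZero p q →* B} {C : Set B} (hC : IsPreconnected C) (hC_one : 1 ∈ C)
    {ρ : B → Matrix (Fin p ⊕ Fin q) (Fin p ⊕ Fin q) ℝ} (hρ : Continuous ρ) (hρ_one : ρ 1 = 1)
    (hform : ∀ b ∈ C, PreservesForm (ρ b)) (heq : ∀ b ∈ C, ∀ g, soMat g.1 = ρ b → Ψ g = b) :
    C ⊆ Ψ.range := by
  intro b hb
  have hdet (c : B) (hc : c ∈ C) : (ρ c).det = 1 := by
    have hpos : 0 < (ρ c).det := by
      refine pos_of_isPreconnected hC hρ.matrix_det.continuousOn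
        (fun d hd => (hform d hd).isUnit_det.ne_zero) hC_one hc ?_
      rw [hρ_one, Matrix.det_one]
      exact one_pos
    exact (pow_eq_one_iff_of_nonneg hpos.le two_ne_zero).1 (hform c hc).det_sq
  obtain ⟨g, hg, hgb⟩ := exists_mem_SOZero_of_isPreconnected hC hρ hform hdet hC_one hb hρ_one
  exact ⟨⟨g, hg⟩, heq b hb _ hgb⟩

theorem continuous_theta (n : ℕ) : Continuous (theta n) := by
  refine isEmbedding_soMat.continuous_iff.2 (continuous_matrix fun i j => ?_)
  have hentry (i j) : Continuous fun g : SO 1 n => soMat g i j :=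
    isEmbedding_soMat.continuous.matrix_elem i j
  change Continuous fun g => thetaMat (soMat g) i j
  rcases i with i | i <;> rcases j with j | j
  · fin_cases i <;> fin_cases j <;> simp [thetaMat, hentry, continuous_const]
  · fin_cases i <;> simp [thetaMat, hentry, continuous_const]
  · fin_cases j <;> simp [thetaMat, hentry, continuous_const]
  · simp [thetaMat, Matrix.toBlocks₂₂, hentry]

theorem theta_mem_SOZero {g : SO 1 n} (hg : g ∈ SOZero 1 n) : theta n g ∈ SOZero 2 n := by
  have himage := (continuous_theta n).image_connectedComponent_subset 1
  rw [map_one] at himage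
  exact himage ⟨g, hg, rfl⟩

/-- The restriction of `θ` to the identity components. -/
def thetaZero (n : ℕ) : SOZero 1 n →* SOZero 2 n :=
  ((theta n).comp (SOZero 1 n).subtype).codRestrict _ fun g => theta_mem_SOZero g.2

theorem continuous_thetaZero (n : ℕ) : Continuous (thetaZero n) :=
  ((continuous_theta n).comp continuous_subtype_val).subtype_mk _

/-- The action of `SO₀(1,n)` on the Lie ball through `θ`. -/
def realActionHom (n : ℕ) : SOZero 1 n →* aut n := (actionHom n).comp (thetaZero n)

theorem continuous_realActionHom (n : ℕ) : Continuous (realActionHom n) :=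
  (continuous_actionHom n).comp (continuous_thetaZero n)

theorem isOrthochronous_thetaMat_of_mem_SOZero {g : SO 1 n} (hg : g ∈ SOZero 1 n) :
    IsOrthochronous (thetaMat (soMat g)) :=
  .of_mem_SOZero (theta_mem_SOZero hg)

/-- The vector `g *ᵥ timelikeLift x`, when the automorphism `h` is induced by the matrix
`thetaMat g`; it is determined by the point `h x` because `thetaMat g` fixes the second coordinate
of `isotropicLift (ofRealVec x)`. -/
def transportedLift (h : aut n) {x : EuclideanSpace ℝ (Fin n)} (hx : ‖x‖ < 1) :
    Fin 1 ⊕ Fin n → ℝ :=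
  let y := reVec n (h.1 ⟨ofRealVec x, ofRealVec_mem_lieBall_iff.2 hx⟩)
  ((1 - ‖x‖ ^ 2) / (1 - ‖y‖ ^ 2)) • timelikeLift y

theorem continuous_transportedLift {x : EuclideanSpace ℝ (Fin n)} (hx : ‖x‖ < 1)
    (k : Fin 1 ⊕ Fin n) : Continuous fun h : aut n => transportedLift h hx k := by
  let z : lieBall n := ⟨ofRealVec x, ofRealVec_mem_lieBall_iff.2 hx⟩
  have hcoe : Continuous fun h : aut n => (⟨h.1, h.1.continuous⟩ : C(lieBall n, lieBall n)) :=
    continuous_induced_dom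
  have heval : Continuous fun h : aut n => h.1 z :=
    (continuous_eval_const (F := C(lieBall n, lieBall n)) z).comp hcoe
  have hy : Continuous fun h : aut n => reVec n (h.1 z) :=
    (reVec n).continuous.comp (continuous_subtype_val.comp heval)
  have hlift : Continuous (timelikeLift (n := n) · k) := by
    rcases k with k | k
    · change Continuous fun y : EuclideanSpace ℝ (Fin n) => (1 + ‖y‖ ^ 2) / 2
      fun_prop
    · exact EuclideanSpace.proj (𝕜 := ℝ) k |>.continuous
  refine (continuous_const.div (continuous_const.sub (hy.norm.pow 2)) fun h => ?_).mul
    (hlift.comp hy)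
  exact (sub_pos.2 ((sq_lt_one_iff₀ (norm_nonneg _)).2
    ((norm_reVec_le _).trans_lt (h.1 z).2.2))).ne'

theorem transportedLift_toAut {g : Matrix (Fin 1 ⊕ Fin n) (Fin 1 ⊕ Fin n) ℝ}
    (hg : IsOrthochronous (thetaMat g)) {x : EuclideanSpace ℝ (Fin n)} (hx : ‖x‖ < 1) :
    transportedLift hg.toAut hx = g *ᵥ timelikeLift x := by
  obtain ⟨-, y, hy⟩ := hg.2.act_thetaMat_mem_realPart (ofRealVec_mem_realPart hx)
  have hy_re : reVec n (act (thetaMat g) (ofRealVec x)) = y := hy ▸ reVec_ofRealVec y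
  rw [hg.2.mulVec_timelikeLift hx hy.symm, ← hy_re]
  rfl

theorem norm_half_smul_single_lt_one (j : Fin n) :
    ‖(1 / 2 : ℝ) • (EuclideanSpace.single j 1 : EuclideanSpace ℝ (Fin n))‖ < 1 := by
  rw [norm_smul, PiLp.norm_single]
  norm_num

/-- The matrix `g`, when the automorphism `h` is induced by the matrix `thetaMat g`. Its columns
are read off from the images of the lifts `e₀ / 2` of the origin and `5 e₀ / 8 + eⱼ / 2` of the
points `eⱼ / 2`. -/
def recoveredMatrix (h : aut n) : Matrix (Fin 1 ⊕ Fin n) (Fin 1 ⊕ Fin n) ℝ :=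
  let v₀ := transportedLift h (x := 0) (by simp)
  Matrix.of fun i => Sum.elim (fun _ => 2 * v₀ i) fun j =>
    2 * transportedLift h (norm_half_smul_single_lt_one j) i - 5 / 2 * v₀ i

theorem continuous_recoveredMatrix (n : ℕ) : Continuous (recoveredMatrix (n := n)) := by
  refine continuous_matrix fun i j => ?_
  rcases j with _ | j
  · exact continuous_const.mul (continuous_transportedLift _ i)
  · exact (continuous_const.mul (continuous_transportedLift _ i)).sub
      (continuous_const.mul (continuous_transportedLift _ i))

theorem recoveredMatrix_toAut {g : Matrix (Fin 1 ⊕ Fin n) (Fin 1 ⊕ Fin n) ℝ}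
    (hg : IsOrthochronous (thetaMat g)) : recoveredMatrix hg.toAut = g := by
  have hzero (i : Fin 1 ⊕ Fin n) : (g *ᵥ timelikeLift 0) i = g i (Sum.inl 0) / 2 := by
    simp [timelikeLift, Matrix.mulVec, dotProduct]
    ring
  have hsingle (i : Fin 1 ⊕ Fin n) (j : Fin n) :
      (g *ᵥ timelikeLift ((1 / 2 : ℝ) • EuclideanSpace.single j 1)) i =
        5 / 8 * g i (Sum.inl 0) + g i (Sum.inr j) / 2 := by
    simp only [timelikeLift, norm_smul, PiLp.norm_single]
    simp [Matrix.mulVec, dotProduct, Pi.single_apply]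
    ring
  ext i (k | k)
  · simp only [recoveredMatrix, transportedLift_toAut, hzero, Matrix.of_apply, Sum.elim_inl,
      Subsingleton.elim k 0]
    ring
  · simp only [recoveredMatrix, transportedLift_toAut, hzero, hsingle, Matrix.of_apply,
      Sum.elim_inr]
    ring

theorem recoveredMatrix_realActionHom (g : SOZero 1 n) :
    recoveredMatrix (realActionHom n g) = soMat g.1 :=
  recoveredMatrix_toAut (isOrthochronous_thetaMat_of_mem_SOZero g.2)

theorem isEmbedding_realActionHom (n : ℕ) : Topology.IsEmbedding (realActionHom n) := by
  refine .of_comp (continuous_realActionHom n) (continuous_recoveredMatrix n) ?_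
  rw [show recoveredMatrix ∘ realActionHom n = fun g => soMat g.1 from
    funext recoveredMatrix_realActionHom]
  exact isEmbedding_soMat.comp Topology.IsEmbedding.subtypeVal

theorem range_realActionHom (n : ℕ) : ((realActionHom n).range : Set (aut n)) = groupH n := by
  have hsubset : ((realActionHom n).range : Set (aut n)) ⊆ groupH n :=
    range_subset_connectedComponentIn (continuous_realActionHom n) fun g =>
      (isOrthochronous_thetaMat_of_mem_SOZero g.2).preservesRealPart_toAut
  have hex (h : aut n) (hh : h ∈ groupH n) : ∃ hg : IsOrthochronous (thetaMat (recoveredMatrix h)),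
      h = hg.toAut := by
    obtain ⟨g, hg, rfl⟩ :=
      PreservesRealPart.exists_eq_toAut (connectedComponentIn_subset _ _ hh).2
    exact ⟨(recoveredMatrix_toAut hg).symm ▸ hg, by simp only [recoveredMatrix_toAut]⟩
  refine hsubset.antisymm (subset_range_of_isPreconnected isPreconnected_connectedComponentIn
    (hsubset (one_mem _)) (continuous_recoveredMatrix n) ?_ (fun h hh => ?_) fun h hh g hgh => ?_)
  · rw [← map_one (realActionHom n), recoveredMatrix_realActionHom]
    rfl
  · exact preservesForm_thetaMat_iff.1 (hex h hh).1.1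
  · obtain ⟨hg, hh_eq⟩ := hex h hh
    rw [hh_eq]
    simp only [← hgh]
    rfl

end GroupH

/-! ### The stabilizer of the real part in `SO₀(2,n)` -/

section Stabilizer

variable {n : ℕ}

/-- The property, for a matrix acting on the Lie ball through the Hua transform, of mapping the real
part into itself. -/
def StabilizesRealPart (g : SO 2 n) : Prop :=
  ∀ x ∈ realPart n, ∃ y ∈ realPart n, hua y = mobius g (hua x)

theorem colZero_mulVec (X : EuclideanSpace ℝ (Fin n)) (u : Fin 2 → ℝ) :
    colZero X *ᵥ u = u 0 • X.ofLp := by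
  ext i
  simp [colZero, Matrix.mulVec, dotProduct, mul_comm]

theorem insertSecond_zero (t : ℝ) :
    insertSecond (0 : Fin 1 ⊕ Fin n → ℝ) t = t • insertSecond 0 1 := by
  ext (k | k)
  · fin_cases k <;> simp [insertSecond]
  · simp [insertSecond]

/-- The submatrix obtained by deleting the second row and column; a left inverse of `thetaMat`. -/
def deleteSecond (g : Matrix (Fin 2 ⊕ Fin n) (Fin 2 ⊕ Fin n) ℝ) :
    Matrix (Fin 1 ⊕ Fin n) (Fin 1 ⊕ Fin n) ℝ :=
  g.submatrix (Sum.map (fun _ => 0) id) (Sum.map (fun _ => 0) id)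

theorem deleteSecond_thetaMat (g : Matrix (Fin 1 ⊕ Fin n) (Fin 1 ⊕ Fin n) ℝ) :
    deleteSecond (thetaMat g) = g := by
  ext (i | i) (j | j) <;>
    simp [deleteSecond, thetaMat, Matrix.toBlocks₂₂, Subsingleton.elim _ (0 : Fin 1)]

theorem continuous_deleteSecond_soMat (n : ℕ) :
    Continuous fun g : SO 2 n => deleteSecond (soMat g) :=
  isEmbedding_soMat.continuous.matrix_submatrix _ _

theorem isEmbedding_theta (n : ℕ) : Topology.IsEmbedding (theta n) := by
  refine .of_comp (continuous_theta n) (continuous_deleteSecond_soMat n) ?_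
  rw [show (fun g : SO 2 n => deleteSecond (soMat g)) ∘ theta n = soMat from
    funext fun g => deleteSecond_thetaMat (soMat g)]
  exact isEmbedding_soMat

theorem soMat_injective_mulVec (g : SO 2 n) : Function.Injective (soMat g *ᵥ ·) :=
  Matrix.mulVec_injective_of_isUnit <| (Matrix.isUnit_iff_isUnit_det _).2 (g.1.2 ▸ isUnit_one)

/-- The second basis vector lies in the graph of every matrix `(Y 0)`. -/
theorem exists_mulVec_eq_insertSecond {g : SO 2 n} {X Y : EuclideanSpace ℝ (Fin n)}
    (hX : colZero X ∈ matBall n) (hXY : mobius g (colZero X) = colZero Y) :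
    ∃ u : Fin 2 → ℝ, soMat g *ᵥ Sum.elim u (u 0 • X.ofLp) = insertSecond 0 1 := by
  have hg : PreservesForm (soMat g) := g.2
  set N := (soMat g).toBlocks₁₁ + (soMat g).toBlocks₁₂ * colZero X with hN
  have hdet : IsUnit N.det := isUnit_iff_ne_zero.2 (hg.det_mobiusDenominator_ne_zero hX)
  refine ⟨N⁻¹ *ᵥ ![0, 1], ?_⟩
  rw [← colZero_mulVec, mulVec_graph, ← hN, Matrix.mulVec_mulVec, Matrix.mulVec_mulVec,
    Matrix.mul_nonsing_inv _ hdet, Matrix.one_mulVec]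
  change Sum.elim _ (mobius g (colZero X) *ᵥ _) = _
  rw [hXY, colZero_mulVec]
  ext (k | k) <;> simp [insertSecond]

theorem StabilizesRealPart.exists_mulVec_eq_insertSecond {g : SO 2 n} (hg : StabilizesRealPart g)
    {X : EuclideanSpace ℝ (Fin n)} (hX : ‖X‖ < 1) :
    ∃ u : Fin 2 → ℝ, soMat g *ᵥ Sum.elim u (u 0 • X.ofLp) = insertSecond 0 1 := by
  obtain ⟨x, hx, hxX⟩ : colZero X ∈ hua '' realPart n := hua_image_realPart ▸ ⟨X, hX, rfl⟩
  obtain ⟨y, hy, hyx⟩ := hg x hx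
  obtain ⟨Y, -, hY⟩ := hua_image_realPart (n := n) ▸ Set.mem_image_of_mem hua hy
  exact LieBall.exists_mulVec_eq_insertSecond (hxX ▸ hua_mem_matBall hx.1)
    (by rw [← hY, hyx, hxX])

/-- The graphs of the matrices `(X 0)` with `|X| < 1` have only the line of the second basis vector
in common. -/
theorem StabilizesRealPart.exists_mulVec_insertSecond (hn : 0 < n) {g : SO 2 n}
    (hg : StabilizesRealPart g) :
    ∃ t : ℝ, t ^ 2 = 1 ∧ soMat g *ᵥ insertSecond 0 1 = insertSecond 0 t := by
  obtain ⟨u, hu⟩ := hg.exists_mulVec_eq_insertSecond (X := 0) (by simp)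
  obtain ⟨v, hv⟩ := hg.exists_mulVec_eq_insertSecond (norm_half_smul_single_lt_one ⟨0, hn⟩)
  have huv := soMat_injective_mulVec g (hu.trans hv.symm)
  have hu_zero : u 0 = 0 := by
    have huv_zero : u 0 = v 0 := congrFun huv (Sum.inl 0)
    have hv_zero : v 0 = 0 := by simpa using congrFun huv.symm (Sum.inr ⟨0, hn⟩)
    rw [huv_zero, hv_zero]
  have hpreimage : soMat g *ᵥ insertSecond 0 (u 1) = insertSecond 0 1 := by
    rw [← hu]
    congr 1
    ext (k | k)
    · fin_cases k <;> simp [insertSecond, hu_zero]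
    · simp [insertSecond]
  have hu_one : u 1 * u 1 = 1 := by
    have hform := g.2 (insertSecond 0 (u 1)) (insertSecond 0 (u 1))
    change form 2 n (soMat g *ᵥ _) (soMat g *ᵥ _) = _ at hform
    rw [hpreimage, form_insertSecond, form_insertSecond] at hform
    linarith
  refine ⟨u 1, sq (u 1) ▸ hu_one, ?_⟩
  rw [insertSecond_zero, Matrix.mulVec_smul] at hpreimage
  calc soMat g *ᵥ insertSecond 0 1
      = u 1 • u 1 • soMat g *ᵥ insertSecond 0 1 := by rw [smul_smul, hu_one, one_smul]
    _ = insertSecond 0 (u 1) := by rw [hpreimage, insertSecond_zero (u 1)]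

theorem soMat_eq_thetaMat_deleteSecond {g : SO 2 n}
    (hg : soMat g *ᵥ insertSecond 0 1 = insertSecond 0 1) :
    soMat g = thetaMat (deleteSecond (soMat g)) := by
  have hcol (k) : soMat g k (Sum.inl 1) = insertSecond (0 : Fin 1 ⊕ Fin n → ℝ) 1 k := by
    rw [← hg]
    simp [Matrix.mulVec, dotProduct, insertSecond]
  have hrow (k) : soMat g (Sum.inl 1) k = insertSecond (0 : Fin 1 ⊕ Fin n → ℝ) 1 k := by
    have hform := g.2 (Pi.single k 1) (insertSecond 0 1)
    change form 2 n (soMat g *ᵥ _) (soMat g *ᵥ _) = _ at hform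
    rw [hg] at hform
    rcases k with k | k
    · fin_cases k <;> simpa [form, insertSecond] using hform
    · simpa [form, insertSecond] using hform
  ext (i | i) (j | j)
  · fin_cases i <;> fin_cases j <;> simp [thetaMat, deleteSecond, hcol, hrow, insertSecond]
  · fin_cases i <;> simp [thetaMat, deleteSecond, hrow, insertSecond]
  · fin_cases j <;> simp [thetaMat, deleteSecond, hcol, insertSecond]
  · simp [thetaMat, deleteSecond, Matrix.toBlocks₂₂]

theorem soMat_eq_thetaMat_of_mem_of_isPreconnected (hn : 0 < n) {C : Set (SO 2 n)}
    (hC : IsPreconnected C) (hC_one : 1 ∈ C) (hreal : ∀ g ∈ C, StabilizesRealPart g)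
    {g : SO 2 n} (hg : g ∈ C) : soMat g = thetaMat (deleteSecond (soMat g)) := by
  have hentry (k : SO 2 n) (hk : k ∈ C) : soMat k (Sum.inl 1) (Sum.inl 1) ^ 2 = 1 ∧
      soMat k *ᵥ insertSecond 0 1 = insertSecond 0 (soMat k (Sum.inl 1) (Sum.inl 1)) := by
    obtain ⟨t, ht, hkt⟩ := (hreal k hk).exists_mulVec_insertSecond hn
    obtain rfl : soMat k (Sum.inl 1) (Sum.inl 1) = t := by
      simpa [Matrix.mulVec, dotProduct, insertSecond] using congrFun hkt (Sum.inl 1)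
    exact ⟨ht, hkt⟩
  have hpos : 0 < soMat g (Sum.inl 1) (Sum.inl 1) := by
    refine pos_of_isPreconnected (f := fun k : SO 2 n => soMat k (Sum.inl 1) (Sum.inl 1)) hC
      (isEmbedding_soMat.continuous.matrix_elem _ _).continuousOn
      (fun k hk hk_zero => ?_) hC_one hg ?_
    · simpa [hk_zero] using (hentry k hk).1
    · simp [soMat]
  obtain ⟨hsq, hfix⟩ := hentry g hg
  rw [(pow_eq_one_iff_of_nonneg hpos.le two_ne_zero).1 hsq] at hfix
  exact soMat_eq_thetaMat_deleteSecond hfix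

/-- The restriction of `θ` to `SO₀(1,n)`, with values in `SO(2,n)`. -/
def thetaRestrict (n : ℕ) : SOZero 1 n →* SO 2 n := (theta n).comp (SOZero 1 n).subtype

theorem isEmbedding_thetaRestrict (n : ℕ) : Topology.IsEmbedding (thetaRestrict n) :=
  (isEmbedding_theta n).comp .subtypeVal

theorem range_thetaRestrict (hn : 0 < n) : ((thetaRestrict n).range : Set (SO 2 n)) =
    connectedComponentIn {g | g ∈ SOZero 2 n ∧ StabilizesRealPart g} 1 := by
  have hsubset : ((thetaRestrict n).range : Set (SO 2 n)) ⊆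
      connectedComponentIn {g | g ∈ SOZero 2 n ∧ StabilizesRealPart g} 1 :=
    range_subset_connectedComponentIn (S := {g | StabilizesRealPart g})
      (isEmbedding_thetaRestrict n).continuous fun g x hx =>
        have hcone := (isOrthochronous_thetaMat_of_mem_SOZero g.2).2
        ⟨_, hcone.act_thetaMat_mem_realPart hx,
          PreservesLieCone.hua_act (g := theta n g.1) hcone hx.1⟩
  have hC_one := hsubset (one_mem _)
  have hreal (g) (hg : g ∈ connectedComponentIn {g | g ∈ SOZero 2 n ∧ StabilizesRealPart g} 1) :
      soMat g = thetaMat (deleteSecond (soMat g)) :=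
    soMat_eq_thetaMat_of_mem_of_isPreconnected hn isPreconnected_connectedComponentIn hC_one
      (fun k hk => (connectedComponentIn_subset _ _ hk).2) hg
  refine hsubset.antisymm (subset_range_of_isPreconnected isPreconnected_connectedComponentIn
    hC_one (continuous_deleteSecond_soMat n) ?_ (fun g hg => ?_) fun g hg k hk => ?_)
  · rw [← map_one (theta n)]
    exact deleteSecond_thetaMat 1
  · rw [← preservesForm_thetaMat_iff, ← hreal g hg]
    exact g.2
  · refine isEmbedding_soMat.injective ?_
    rw [hreal g hg, ← hk]
    rfl

end Stabilizer

end LieBall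

end

theorem mainTheorem8_general (n : ℕ) (hn : 0 < n) :
    Set.BijOn LieBall.hua (LieBall.lieBall n) (LieBall.matBall n) ∧
    LieBall.hua '' LieBall.realPart n =
      {Z | ∃ X : EuclideanSpace ℝ (Fin n), ‖X‖ < 1 ∧ Z = LieBall.colZero X} ∧
    (∃ φ : OpenPartialHomeomorph (EuclideanSpace ℝ (Fin n)) (EuclideanSpace ℝ (Fin n)),
      φ.source = {x | LieBall.ofRealVec x ∈ LieBall.lieBall n} ∧
      φ.target = {X | ‖X‖ < 1} ∧
      ContDiffOn ℝ ∞ φ φ.source ∧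
      ContDiffOn ℝ ∞ φ.symm φ.target ∧
      ∀ x ∈ φ.source, φ x = (2 / (1 + ‖x‖ ^ 2)) • x ∧
        LieBall.hua (LieBall.ofRealVec x) = LieBall.colZero (φ x)) ∧
    (∃ H : Subgroup (LieBall.aut n), (H : Set (LieBall.aut n)) = LieBall.groupH n ∧
      ∃ Φ : H ≃ₜ* LieBall.SOZero 1 n, ∀ (h : H) (z : LieBall.lieBall n),
        LieBall.hua (h.1.1 z) =
          LieBall.mobius (LieBall.theta n (Φ h).1) (LieBall.hua z)) ∧
    (∃ H : Subgroup (LieBall.SO 2 n),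
      (H : Set (LieBall.SO 2 n)) =
        connectedComponentIn
          {g | g ∈ LieBall.SOZero 2 n ∧ ∀ x ∈ LieBall.realPart n, ∃ y ∈ LieBall.realPart n,
            LieBall.hua y = LieBall.mobius g (LieBall.hua x)} 1 ∧
      ∃ Φ : H ≃ₜ* LieBall.SOZero 1 n, ∀ h : H, LieBall.theta n (Φ h).1 = h.1) := by
  refine ⟨LieBall.hua_bijOn, LieBall.hua_image_realPart,
    ⟨LieBall.poincareToKlein _, ?_, ?_, LieBall.contDiffOn_poincareToKlein,
      LieBall.contDiffOn_poincareToKlein_symm, fun x hx => ⟨rfl, ?_⟩⟩,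
    ⟨(LieBall.realActionHom n).range, LieBall.range_realActionHom n, ?_⟩,
    ⟨(LieBall.thetaRestrict n).range, LieBall.range_thetaRestrict hn, ?_⟩⟩
  · ext x
    exact mem_ball_zero_iff.trans LieBall.ofRealVec_mem_lieBall_iff.symm
  · ext X
    exact mem_ball_zero_iff
  · exact LieBall.hua_ofRealVec (mem_ball_zero_iff.1 hx)
  · obtain ⟨Φ, hΦ⟩ :=
      LieBall.exists_range_continuousMulEquiv (LieBall.isEmbedding_realActionHom n)
    refine ⟨Φ, fun h z => ?_⟩
    rw [← hΦ h]
    exact LieBall.hua_actionHom (LieBall.thetaZero n (Φ h)) z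
  · exact LieBall.exists_range_continuousMulEquiv (LieBall.isEmbedding_thetaRestrict n)

theorem mainTheorem8 (n : ℕ) (hn : 2 < n) :
    -- the Hua transform is a bijection of the Lie ball onto `M`
    Set.BijOn LieBall.hua (LieBall.lieBall n) (LieBall.matBall n) ∧
    -- it maps the real part onto `{(X 0) | |X| < 1}`
    LieBall.hua '' LieBall.realPart n =
      {Z | ∃ X : EuclideanSpace ℝ (Fin n), ‖X‖ < 1 ∧ Z = LieBall.colZero X} ∧
    -- diffeomorphically, by `x ↦ 2x / (1 + |x|²)`
    (∃ φ : OpenPartialHomeomorph (EuclideanSpace ℝ (Fin n)) (EuclideanSpace ℝ (Fin n)),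
      φ.source = {x | LieBall.ofRealVec x ∈ LieBall.lieBall n} ∧
      φ.target = {X | ‖X‖ < 1} ∧
      ContDiffOn ℝ ∞ φ φ.source ∧
      ContDiffOn ℝ ∞ φ.symm φ.target ∧
      ∀ x ∈ φ.source, φ x = (2 / (1 + ‖x‖ ^ 2)) • x ∧
        LieBall.hua (LieBall.ofRealVec x) = LieBall.colZero (φ x)) ∧
    -- `H` is a group and `h ↦ 𝓗 h 𝓗⁻¹` is an isomorphism of `H` onto `SO₀(1,n)`,
    -- which acts on `M` as a subgroup of `SO(2,n)`; here `G = Aut(𝓓)₀`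
    (∃ H : Subgroup (LieBall.aut n), (H : Set (LieBall.aut n)) = LieBall.groupH n ∧
      ∃ Φ : H ≃ₜ* LieBall.SOZero 1 n, ∀ (h : H) (z : LieBall.lieBall n),
        LieBall.hua (h.1.1 z) =
          LieBall.mobius (LieBall.theta n (Φ h).1) (LieBall.hua z)) ∧
    -- the same for `G = SO₀(2,n)` acting on the Lie ball by `z ↦ 𝓗⁻¹(g 𝓗(z))`
    (∃ H : Subgroup (LieBall.SO 2 n),
      (H : Set (LieBall.SO 2 n)) =
        connectedComponentIn
          {g | g ∈ LieBall.SOZero 2 n ∧ ∀ x ∈ LieBall.realPart n, ∃ y ∈ LieBall.realPart n,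
            LieBall.hua y = LieBall.mobius g (LieBall.hua x)} 1 ∧
      ∃ Φ : H ≃ₜ* LieBall.SOZero 1 n, ∀ h : H, LieBall.theta n (Φ h).1 = h.1) :=
  mainTheorem8_general n (by lia)
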